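/- Let $\mathcal{A}$ be a $W^*$-algebra (a $C^*$-algebra that is isometrically isomorphic to the dual of a Banach space), and let $H_{\mathcal{A}}=\ell_2(\mathcal{A})$ be the standard Hilbert $C^*$-module over $\mathcal{A}$: the left $\mathcal{A}$-module of all sequences $x=(x_n)_{n\ge 0}$ in $\mathcal{A}$ such that $\sum_n x_nx_n^*$ converges in norm, with the $\mathcal{A}$-valued inner product $\langle x,y\rangle=\sum_n y_nx_n^*$ and the norm $\|x\|=\|\langle x,x\rangle\|^{1/2}$. Let $B^a(H_{\mathcal{A}})$ be the set of bounded $\mathcal{A}$-linear operators $F$ on $H_{\mathcal{A}}$ that have an adjoint, i.e. a bounded $\mathcal{A}$-linear operator $F^*$ with $\langle Fx,y\rangle=\langle x,F^*y\rangle$ for all $x,y$. Let $K^*(H_{\mathcal{A}})\subseteq B^a(H_{\mathcal{A}})$ be the set of adjointable compact operators: the elements of $B^a(H_{\mathcal{A}})$ that lie in the operator-norm closure of the complex linear span of the operators $z\mapsto\langle y,z\rangle x$, $x,y\in H_{\mathcal{A}}$. For a submodule $M\subseteq H_{\mathcal{A}}$ put $M^\perp=\{y:\langle x,y\rangle=0\text{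 for all }x\in M\}$. A submodule is called finitely generated if it is the $\mathcal{A}$-linear span of a finite set. An operator $F\in B^a(H_{\mathcal{A}})$ is called lower semi-$\mathcal{A}$-Fredholm if there are closed submodules $M_1,N_1,M_2,N_2$ of $H_{\mathcal{A}}$ with $H_{\mathcal{A}}=M_1\,\tilde\oplus\,N_1=M_2\,\tilde\oplus\,N_2$ (direct sums, not necessarily orthogonal) such that $F(M_1)\subseteq M_2$, $F(N_1)\subseteq N_2$, the restriction $F|_{M_1}\colon M_1\to M_2$ is an isomorphism (bounded, $\mathcal{A}$-linear, with bounded inverse), and $N_2$ is finitely generated. **Corollary.** Let $F\in B^a(H_{\mathcal{A}})$. Then $F$ is lower semi-$\mathcal{A}$-Fredholm if and only if $\operatorname{Im}(F-K)^\perp$ is finitely generated for every $K\in K^*(H_{\mathcal{A}})$. -/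

import Mathlib

open scoped InnerProductSpace

section StandardModule

variable {A : Type*} [CStarAlgebra A] [PartialOrder A] [StarOrderedRing A]

/-- Comparison test for series of positive elements of a C⋆-algebra. -/
theorem summable_of_nonneg_of_le_cstar {f g : ℕ → A} (hf : ∀ n, 0 ≤ f n) (hfg : ∀ n, f n ≤ g n)
    (hg : Summable g) : Summable f := by
  rw [summable_iff_vanishing_norm] at hg ⊢
  intro ε hε
  obtain ⟨s, hs⟩ := hg ε hε
  refine ⟨s, fun t ht => lt_of_le_of_lt ?_ (hs t ht)⟩
  exact CStarAlgebra.norm_le_norm_of_nonneg_of_le (Finset.sum_nonneg fun i _ => hf i)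
    (Finset.sum_le_sum fun i _ => hfg i)

theorem summable_add_mul_star {x y : ℕ → A} (hx : Summable fun n => x n * star (x n))
    (hy : Summable fun n => y n * star (y n)) :
    Summable fun n => (x n + y n) * star (x n + y n) := by
  refine summable_of_nonneg_of_le_cstar (fun n => mul_star_self_nonneg _) (fun n => ?_)
    ((hx.add hy).add (hx.add hy))
  have h : 0 ≤ (x n - y n) * star (x n - y n) := mul_star_self_nonneg _
  rw [← sub_nonneg]
  convert h using 1
  simp only [star_add, star_sub]
  noncomm_ring

variable (A) in
/-- The square-summable sequences: those `x : ℕ → A` for which the series `∑ xₙ xₙ⋆` converges in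
norm (its terms are positive, so its convergence is automatically unconditional). -/
def squareSummable : Submodule A (ℕ → A) where
  carrier := {x | Summable fun n => x n * star (x n)}
  add_mem' hx hy := summable_add_mul_star hx hy
  zero_mem' := by simp
  smul_mem' a x hx := by
    have h : Summable fun n => a * (x n * star (x n)) * star a := (hx.mul_left a).mul_right _
    simpa [mul_assoc] using h

variable (A) in
/-- The standard Hilbert C⋆-module `H_A = ℓ²(A)`. It is a type synonym of the space of
square-summable sequences, so that it does not carry the topology of pointwise convergence.
Sides are those of Mathlib's `CStarModule`: the algebra acts on the left, and the inner product
is `A`-linear in its second variable. -/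
def StdModule : Type _ := squareSummable A

namespace StdModule

noncomputable instance : AddCommGroup (StdModule A) :=
  inferInstanceAs (AddCommGroup (squareSummable A))
noncomputable instance : Module A (StdModule A) :=
  inferInstanceAs (Module A (squareSummable A))
noncomputable instance : Module ℂ (StdModule A) :=
  inferInstanceAs (Module ℂ (squareSummable A))
instance : IsScalarTower ℂ A (StdModule A) :=
  inferInstanceAs (IsScalarTower ℂ A (squareSummable A))

/-- The `n`-th coordinate of an element of `H_A`. -/
def coord (x : StdModule A) (n : ℕ) : A := x.1 n

@[ext] theorem ext {x y : StdModule A} (h : ∀ n, x.coord n = y.coord n) : x = y :=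
  Subtype.ext (funext h)

@[simp] theorem coord_zero (n : ℕ) : (0 : StdModule A).coord n = 0 := rfl
@[simp] theorem coord_add (x y : StdModule A) (n : ℕ) :
    (x + y).coord n = x.coord n + y.coord n := rfl
@[simp] theorem coord_smul (a : A) (x : StdModule A) (n : ℕ) :
    (a • x).coord n = a * x.coord n := rfl
@[simp] theorem coord_smul_complex (c : ℂ) (x : StdModule A) (n : ℕ) :
    (c • x).coord n = c • x.coord n := rfl

theorem summable_self (x : StdModule A) : Summable fun n => x.coord n * star (x.coord n) := x.2

theorem summable_inner (x y : StdModule A) :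
    Summable fun n => y.coord n * star (x.coord n) := by
  have h1 := (y + x).summable_self
  have h2 := (y + (-1 : ℂ) • x).summable_self
  have h3 := (y + Complex.I • x).summable_self
  have h4 := (y + (-Complex.I) • x).summable_self
  have h := (((h1.sub h2).add ((h3.sub h4).const_smul Complex.I))).const_smul (1 / 4 : ℂ)
  refine h.congr fun n => ?_
  simp only [coord_add, coord_smul_complex, star_add, star_smul, mul_add, add_mul, smul_mul_assoc,
    mul_smul_comm, smul_add, smul_sub, smul_smul, RCLike.star_def, map_neg, map_one,
    Complex.conj_I]
  match_scalars <;> ring_nf <;> simp; norm_num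

/-- The norm `‖x‖ = ‖⟨x, x⟩‖ ^ (1/2)` on `H_A`. -/
noncomputable instance : Norm (StdModule A) where
  norm x := √‖∑' n, x.coord n * star (x.coord n)‖

/-- The `A`-valued inner product `⟨x, y⟩ = ∑ yₙ xₙ⋆` on `H_A`. -/
noncomputable instance : CStarModule A (StdModule A) where
  inner x y := ∑' n, y.coord n * star (x.coord n)
  inner_add_right {x y z} := by
    simp only [coord_add, add_mul]
    exact (summable_inner x y).tsum_add (summable_inner x z)
  inner_self_nonneg {x} := tsum_nonneg fun n => mul_star_self_nonneg _
  inner_self {x} := by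
    refine ⟨fun h => ?_, fun h => by simp [h]⟩
    have h0 := (hasSum_zero_iff_of_nonneg (fun n => mul_star_self_nonneg (x.coord n))).1
      (h ▸ x.summable_self.hasSum)
    ext n
    exact (CStarRing.mul_star_self_eq_zero_iff _).1 (congrFun h0 n)
  inner_op_smul_right {a x y} := by
    simp only [coord_smul, mul_assoc]
    exact (summable_inner x y).tsum_mul_left a
  inner_smul_right_complex {c x y} := by
    simp only [coord_smul_complex, smul_mul_assoc]
    exact (summable_inner x y).tsum_const_smul c
  star_inner x y := by simp [tsum_star]
  norm_eq_sqrt_norm_inner_self x := rfl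

noncomputable instance : NormedAddCommGroup (StdModule A) := CStarModule.normedAddCommGroup A
noncomputable instance : NormedSpace ℂ (StdModule A) :=
  NormedSpace.ofCore (CStarModule.normedSpaceCore A)

end StdModule

end StandardModule

section Operators

variable {A E : Type*} [CStarAlgebra A] [PartialOrder A] [StarOrderedRing A]
  [NormedAddCommGroup E] [NormedSpace ℂ E] [Module A E] [IsScalarTower ℂ A E] [CStarModule A E]

/-- A bounded `A`-linear operator is adjointable if it has an adjoint for the `A`-valued inner
product; the set of adjointable operators is `Bᵃ(E)`. -/
def IsAdjointable (F : E →L[A] E) : Prop :=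
  ∃ G : E →L[A] E, ∀ x y : E, ⟪F x, y⟫_A = ⟪x, G y⟫_A

/-- The elementary operator `z ↦ ⟨y, z⟩ x`. -/
noncomputable def elementaryOp (x y : E) : E →L[A] E where
  toFun z := ⟪y, z⟫_A • x
  map_add' z w := by simp [add_smul]
  map_smul' a z := by simp [mul_smul]
  cont := by
    refine AddMonoidHomClass.continuous_of_bound
      (AddMonoidHom.mk' (fun z : E => ⟪y, z⟫_A • x) fun z w => by simp [add_smul])
      (‖y‖ * ‖x‖) fun z => ?_
    have key : ‖⟪y, z⟫_A • x‖ ≤ ‖⟪y, z⟫_A‖ * ‖x‖ := by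
      refine le_of_sq_le_sq ?_ (by positivity)
      rw [CStarModule.norm_sq_eq A, mul_pow, CStarModule.norm_sq_eq A (x := x),
        CStarModule.inner_op_smul_right, CStarModule.inner_op_smul_left]
      calc _ ≤ ‖⟪y, z⟫_A‖ * (‖⟪x, x⟫_A‖ * ‖star ⟪y, z⟫_A‖) :=
            (norm_mul_le _ _).trans (by gcongr; exact norm_mul_le _ _)
        _ = ‖⟪y, z⟫_A‖ ^ 2 * ‖⟪x, x⟫_A‖ := by rw [norm_star]; ring
    have h2 : ‖⟪y, z⟫_A‖ ≤ ‖y‖ * ‖z‖ := CStarModule.norm_inner_le E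
    calc ‖⟪y, z⟫_A • x‖ ≤ ‖⟪y, z⟫_A‖ * ‖x‖ := key
      _ ≤ (‖y‖ * ‖z‖) * ‖x‖ := by gcongr
      _ = ‖y‖ * ‖x‖ * ‖z‖ := by ring

/-- The adjointable compact operators `K⋆(E)`: the adjointable operators in the operator-norm
closure of the complex linear span of the elementary operators. -/
def IsCompactAdjointable (K : E →L[A] E) : Prop :=
  IsAdjointable K ∧
    K.restrictScalars ℂ ∈ closure ((Submodule.span ℂ
      {T : E →L[ℂ] E | ∃ x y : E, T = (elementaryOp (A := A) x y).restrictScalars ℂ} :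
        Submodule ℂ (E →L[ℂ] E)) : Set (E →L[ℂ] E))

/-- The orthogonal complement of a submodule. -/
def orthogonalComplement (M : Submodule A E) : Submodule A E where
  carrier := {y | ∀ x ∈ M, ⟪x, y⟫_A = 0}
  add_mem' hy hz x hx := by simp [hy x hx, hz x hx]
  zero_mem' x _ := by simp
  smul_mem' a y hy x hx := by simp [hy x hx]

/-- An adjointable operator `F` is lower semi-`A`-Fredholm if there are decompositions
`E = M₁ ⊕ N₁` and `E = M₂ ⊕ N₂` of the domain and the codomain into closed submodules (direct, not
necessarily orthogonal) with respect to which `F` is diagonal, `F : M₁ → M₂` is an isomorphism and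
`N₂` is finitely generated. -/
def IsLowerSemiFredholm (F : E →L[A] E) : Prop :=
  IsAdjointable F ∧
  ∃ M₁ N₁ M₂ N₂ : Submodule A E,
    IsClosed (M₁ : Set E) ∧ IsClosed (N₁ : Set E) ∧
    IsClosed (M₂ : Set E) ∧ IsClosed (N₂ : Set E) ∧
    IsCompl M₁ N₁ ∧ IsCompl M₂ N₂ ∧
    (∃ F₁ : M₁ ≃L[A] M₂, ∀ x : M₁, (F₁ x : E) = F x) ∧
    (∀ x ∈ N₁, F x ∈ N₂) ∧
    N₂.FG

end Operators

/-!
Write `T = F⋆`, let `P n` and `Q n = 1 - P n` be the projections of `H_A` onto the first `n`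
coordinates and onto the remaining ones, and note that `Im(F - K)^⊥ = ker(T - K⋆)`. Both conditions
of the theorem are equivalent to a third one: `T` is bounded below on the range of `Q n` for some
`n`.

If `F` is lower semi-Fredholm, then `Im F` and a finitely generated submodule span `H_A`. By the
open mapping theorem `T` is bounded below on a tail (`StdModule.bounded_below_tail_of_range_add_fg`),
and this persists for `T - K⋆` because `K⋆` is small on tails
(`StdModule.eventually_norm_adjoint_tail_le`). The compression `S = Q T⋆ T Q + P` of an operator that
is bounded below on the tail is invertible (`StdModule.exists_inverse_compression`), by a Lax–Milgram
argument. Hence the vectors of the kernel are determined `A`-linearly by their first `n`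
coordinates, and the kernel is the image of the kernel of an `A`-linear map `G` on `Aⁿ`
(`StdModule.fg_ker_of_bounded_below`). This is the place where the predual is needed: kernels of such
maps are finitely generated over a W⋆-algebra (`StdModule.fg_ker_inf_range_trunc`). With `D = G⋆G` a
contraction, the powers `(1 - D)ᵏ` decrease, and the entrywise weak-⋆ limit `E` of these matrices
along an ultrafilter satisfies `a E = a` for rows `a` in the kernel and `E D = 0`, so that its rows
generate the kernel. Passing to the limit in products does not require that multiplication is
separately weak-⋆ continuous: contractivity and unitality of the limit `Λ` make it positive
(`IsGeneralizedLimit.nonneg`), so it sends decreasing sequences to their infima, and infima are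
preserved by `z ↦ x z x⋆` for invertible `x`, hence by linearity for all `x`
(`IsGeneralizedLimit.map_conj`).

Conversely, if `T` is bounded below on no tail, there are unit vectors `xₖ` with disjoint supports
tending to infinity and with `∑ ‖T xₖ‖ < ∞`. Functional calculus of `⟨xₖ, xₖ⟩` turns them into
vectors on which `T` agrees with the adjoint of a compact `K` (`exists_cutoff`), so that
`ker(T - K⋆)` contains a weakly null sequence that is not norm null; this is impossible in a closed
finitely generated submodule (`StdModule.tendsto_zero_of_mem_fg`). So `T` is bounded below on a tail,
and then `V = T Q S⁻¹ Q` is a right inverse of `Q F` on the range of `Q`; the idempotents `V F` and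
`F V` give the required decompositions (`StdModule.isLowerSemiFredholm_of_bounded_below`).
-/

set_option linter.unusedSectionVars false

/-! ### The standard module -/

namespace StdModule

open Filter Topology

variable {A : Type*} [CStarAlgebra A] [PartialOrder A] [StarOrderedRing A]

theorem inner_eq_tsum (x y : StdModule A) :
    ⟪x, y⟫_A = ∑' n, y.coord n * star (x.coord n) := rfl

@[simp] theorem coord_sub (x y : StdModule A) (n : ℕ) :
    (x - y).coord n = x.coord n - y.coord n := rfl

@[simp] theorem coord_sum {ι : Type*} (s : Finset ι) (f : ι → StdModule A) (n : ℕ) :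
    (∑ i ∈ s, f i).coord n = ∑ i ∈ s, (f i).coord n :=
  map_sum (⟨⟨fun x : StdModule A => x.coord n, rfl⟩, fun _ _ => rfl⟩ : StdModule A →+ A) f s

/-- The element of `H_A` given by a square-summable sequence. -/
def ofSummable (y : ℕ → A) (h : Summable fun n => y n * star (y n)) : StdModule A := ⟨y, h⟩

@[simp] theorem coord_ofSummable (y : ℕ → A) (h : Summable fun n => y n * star (y n)) (n : ℕ) :
    (ofSummable y h).coord n = y n := rfl

/-- The sequence with entry `1` at `i` and `0` elsewhere. -/
noncomputable def basisVec (i : ℕ) : StdModule A :=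
  ofSummable (Pi.single i 1) <| summable_of_ne_finset_zero (s := {i}) fun j hj => by
    simp [Pi.single_eq_of_ne (by simpa using hj)]

theorem coord_basisVec (i j : ℕ) :
    (basisVec i : StdModule A).coord j = if j = i then 1 else 0 := by
  rw [basisVec, coord_ofSummable, Pi.single_apply]

@[simp] theorem inner_basisVec (i : ℕ) (x : StdModule A) :
    ⟪(basisVec i : StdModule A), x⟫_A = x.coord i := by
  rw [inner_eq_tsum, tsum_eq_single i]
  · simp [coord_basisVec]
  · intro j hj
    simp [coord_basisVec, hj]

theorem norm_basisVec_le (i : ℕ) : ‖(basisVec i : StdModule A)‖ ≤ 1 := by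
  have h := CStarModule.norm_sq_eq A (x := (basisVec i : StdModule A))
  rw [inner_basisVec, coord_basisVec, if_pos rfl] at h
  rcases subsingleton_or_nontrivial A with hA | hA
  · rw [Subsingleton.elim (1 : A) 0, norm_zero] at h
    rw [pow_eq_zero_iff two_ne_zero] at h
    rw [h]
    exact zero_le_one
  rw [norm_one] at h
  exact le_of_sq_le_sq (h.le.trans_eq (one_pow 2).symm) zero_le_one

theorem norm_coord_le (x : StdModule A) (i : ℕ) : ‖x.coord i‖ ≤ ‖x‖ := by
  rw [← inner_basisVec]
  refine (CStarModule.norm_inner_le _).trans ?_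
  exact mul_le_of_le_one_left (norm_nonneg _) (norm_basisVec_le i)

theorem norm_sum_coord_le (x : StdModule A) (s : Finset ℕ) :
    ‖∑ i ∈ s, x.coord i * star (x.coord i)‖ ≤ ‖x‖ ^ 2 := by
  rw [CStarModule.norm_sq_eq A, inner_eq_tsum]
  exact CStarAlgebra.norm_le_norm_of_nonneg_of_le
    (Finset.sum_nonneg fun i _ => mul_star_self_nonneg _)
    (x.summable_self.sum_le_tsum s fun i _ => mul_star_self_nonneg _)

theorem norm_sq_le_of_forall_sum (x : StdModule A) {r : ℝ}
    (h : ∀ s : Finset ℕ, ‖∑ i ∈ s, x.coord i * star (x.coord i)‖ ≤ r) : ‖x‖ ^ 2 ≤ r := by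
  rw [CStarModule.norm_sq_eq A, inner_eq_tsum]
  exact le_of_tendsto x.summable_self.hasSum.norm (Eventually.of_forall h)

instance : CompleteSpace (StdModule A) := by
  refine Metric.complete_of_cauchySeq_tendsto fun u hu => ?_
  have hc : ∀ i, CauchySeq fun k => (u k).coord i := fun i => by
    rw [Metric.cauchySeq_iff'] at hu ⊢
    intro ε hε
    obtain ⟨N, hN⟩ := hu ε hε
    refine ⟨N, fun n hn => lt_of_le_of_lt ?_ (hN n hn)⟩
    rw [dist_eq_norm, dist_eq_norm, ← coord_sub]
    exact norm_coord_le _ i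
  choose y hy using fun i => cauchySeq_tendsto_of_complete (hc i)
  -- The differences `u k - y` are small, uniformly in finite sets of coordinates.
  have hsmall : ∀ ε > 0, ∃ N, ∀ k ≥ N, ∀ s : Finset ℕ,
      ‖∑ i ∈ s, ((u k).coord i - y i) * star ((u k).coord i - y i)‖ ≤ ε ^ 2 := by
    intro ε hε
    obtain ⟨N, hN⟩ := Metric.cauchySeq_iff.1 hu ε hε
    refine ⟨N, fun k hk s => ?_⟩
    have ht : Tendsto (fun l => ‖∑ i ∈ s, ((u k).coord i - (u l).coord i) *
        star ((u k).coord i - (u l).coord i)‖) atTop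
        (𝓝 ‖∑ i ∈ s, ((u k).coord i - y i) * star ((u k).coord i - y i)‖) :=
      (tendsto_finsetSum _ fun i _ => (tendsto_const_nhds.sub (hy i)).mul
        (tendsto_const_nhds.sub (hy i)).star).norm
    refine le_of_tendsto ht ?_
    filter_upwards [eventually_ge_atTop N] with l hl
    have h1 := norm_sum_coord_le (u k - u l) s
    have h2 := hN k hk l hl
    rw [dist_eq_norm] at h2
    simp only [coord_sub] at h1
    exact h1.trans (by gcongr)
  have hsum : Summable fun i => y i * star (y i) := by
    rw [summable_iff_vanishing_norm]
    intro ε hε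
    obtain ⟨N, hN⟩ := hsmall (√(ε / 5)) (by positivity)
    obtain ⟨s, hs⟩ := summable_iff_vanishing_norm.1 (u N).summable_self (ε / 5) (by positivity)
    refine ⟨s, fun t ht => ?_⟩
    have h1 := hN N le_rfl t
    have h2 := hs t ht
    rw [Real.sq_sqrt (by positivity)] at h1
    have h3 : ∑ i ∈ t, y i * star (y i) ≤ (2 : ℝ) • (∑ i ∈ t, (u N).coord i * star ((u N).coord i) +
        ∑ i ∈ t, ((u N).coord i - y i) * star ((u N).coord i - y i)) := by
      rw [← Finset.sum_add_distrib, Finset.smul_sum]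
      refine Finset.sum_le_sum fun i _ => ?_
      have h : 0 ≤ ((u N).coord i + ((u N).coord i - y i)) *
        star ((u N).coord i + ((u N).coord i - y i)) := mul_star_self_nonneg _
      rw [← sub_nonneg, two_smul]
      convert h using 1
      simp only [star_add, star_sub]
      noncomm_ring
    have h4 := CStarAlgebra.norm_le_norm_of_nonneg_of_le
      (Finset.sum_nonneg fun i _ => mul_star_self_nonneg _) h3
    rw [norm_smul, Real.norm_ofNat] at h4
    have h5 := norm_add_le (∑ i ∈ t, (u N).coord i * star ((u N).coord i))
      (∑ i ∈ t, ((u N).coord i - y i) * star ((u N).coord i - y i))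
    linarith
  refine ⟨ofSummable y hsum, ?_⟩
  rw [Metric.tendsto_atTop]
  intro ε hε
  obtain ⟨N, hN⟩ := hsmall (ε / 2) (by positivity)
  refine ⟨N, fun n hn => ?_⟩
  rw [dist_eq_norm]
  have h := norm_sq_le_of_forall_sum (u n - ofSummable y hsum) (hN n hn)
  have := le_of_sq_le_sq h (by positivity)
  linarith

/-- The projection `P n` onto the first `n` coordinates. -/
noncomputable def trunc (n : ℕ) : StdModule A →L[A] StdModule A :=
  ∑ i ∈ Finset.range n, elementaryOp (A := A) (basisVec i) (basisVec i)

theorem trunc_apply (n : ℕ) (x : StdModule A) :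
    trunc n x = ∑ i ∈ Finset.range n, x.coord i • (basisVec i : StdModule A) := by
  simp [trunc, elementaryOp]

theorem coord_trunc (n : ℕ) (x : StdModule A) (j : ℕ) :
    (trunc n x).coord j = if j < n then x.coord j else 0 := by
  simp [trunc_apply, coord_basisVec]

@[simp] theorem trunc_trunc (n : ℕ) (x : StdModule A) : trunc n (trunc n x) = trunc n x := by
  ext j
  simp only [coord_trunc]
  split_ifs <;> rfl

theorem inner_trunc_left (n : ℕ) (x y : StdModule A) :
    ⟪trunc n x, y⟫_A = ⟪x, trunc n y⟫_A := by
  simp only [inner_eq_tsum, coord_trunc]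
  refine tsum_congr fun j => ?_
  split_ifs <;> simp

theorem tendsto_sub_trunc (x : StdModule A) :
    Tendsto (fun n => x - trunc n x) atTop (𝓝 0) := by
  have h1 : ∀ n, ‖x - trunc n x‖ =
      √‖∑' k, x.coord (k + n) * star (x.coord (k + n))‖ := by
    intro n
    rw [CStarModule.norm_eq_sqrt_norm_inner_self (A := A), inner_eq_tsum,
      ← ((x - trunc n x).summable_self).sum_add_tsum_nat_add n]
    rw [Finset.sum_eq_zero, zero_add]
    · simp [coord_trunc]
    · intro i hi
      simp [coord_trunc, Finset.mem_range.1 hi]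
  rw [tendsto_zero_iff_norm_tendsto_zero]
  simp only [h1]
  have h2 := (tendsto_sum_nat_add fun k => x.coord k * star (x.coord k)).norm.sqrt
  simpa using h2

end StdModule

/-! ### Operators on Hilbert modules -/

section HilbertModule

variable {A E : Type*} [CStarAlgebra A] [PartialOrder A] [StarOrderedRing A]
  [NormedAddCommGroup E] [NormedSpace ℂ E] [Module A E] [IsScalarTower ℂ A E] [CStarModule A E]

theorem CStarModule.norm_smul_le (a : A) (x : E) : ‖a • x‖ ≤ ‖a‖ * ‖x‖ := by
  refine le_of_sq_le_sq ?_ (by positivity)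
  rw [CStarModule.norm_sq_eq A, mul_pow, CStarModule.norm_sq_eq A (x := x),
    CStarModule.inner_op_smul_right, CStarModule.inner_op_smul_left]
  calc _ ≤ ‖a‖ * (‖⟪x, x⟫_A‖ * ‖star a‖) :=
        (norm_mul_le _ _).trans (by gcongr; exact norm_mul_le _ _)
    _ = ‖a‖ ^ 2 * ‖⟪x, x⟫_A‖ := by rw [norm_star]; ring

/-- A norm inequality between `A`-linear maps holds already for the `A`-valued inner products:
the norm inequality is applied to `b • x`, where `b` normalizes `⟨V x, V x⟩`. -/
theorem LinearMap.inner_self_le_of_norm_le (U V : E →ₗ[A] E)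
    (h : ∀ x, ‖U x‖ ≤ ‖V x‖) (x : E) : ⟪U x, U x⟫_A ≤ ⟪V x, V x⟫_A := by
  have key : ∀ ε : ℝ, 0 < ε → ⟪U x, U x⟫_A ≤ ⟪V x, V x⟫_A + algebraMap ℝ A ε := by
    intro ε hε
    set a := ⟪V x, V x⟫_A + algebraMap ℝ A ε with ha
    have hε' : IsStrictlyPositive (algebraMap ℝ A ε) :=
      ⟨algebraMap_nonneg A hε.le, (isUnit_iff_ne_zero.2 hε.ne').map _⟩
    have hle : algebraMap ℝ A ε ≤ a := le_add_of_nonneg_left CStarModule.inner_self_nonneg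
    have ha0 : 0 ≤ a := hε'.nonneg.trans hle
    have hu : IsUnit (CFC.sqrt a) := (CFC.isUnit_sqrt_iff a).2 (CStarAlgebra.isUnit_of_le _ hle)
    have hs : star (CFC.sqrt a) = CFC.sqrt a :=
      (IsSelfAdjoint.of_nonneg (CFC.sqrt_nonneg a)).star_eq
    have hss : CFC.sqrt a * CFC.sqrt a = a := CFC.sqrt_mul_sqrt_self a
    obtain ⟨d, hd⟩ := hu
    rw [← hd] at hs hss
    set b : A := ↑d⁻¹ with hb
    have hbd : b * d = 1 := d.inv_mul
    have hdb : d * b = 1 := d.mul_inv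
    have hbs : star b = b := by
      have h1 : star b * d = 1 := by
        rw [← hs, ← star_mul, hdb, star_one]
      calc star b = star b * (d * b) := by rw [hdb, mul_one]
        _ = b := by rw [← mul_assoc, h1, one_mul]
    have hV : ⟪V (b • x), V (b • x)⟫_A ≤ 1 := by
      rw [map_smul, CStarModule.inner_op_smul_left, CStarModule.inner_op_smul_right]
      have h1 : ⟪V x, V x⟫_A ≤ a := le_add_of_nonneg_right hε'.nonneg
      have h2 := star_right_conjugate_le_conjugate h1 b
      have h3 : b * a * star b = 1 := by
        rw [hbs, ← hss, ← mul_assoc, hbd, one_mul, hdb]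
      rwa [h3, mul_assoc, ← mul_assoc] at h2
    have hU : ⟪U (b • x), U (b • x)⟫_A ≤ 1 := by
      rw [← CStarAlgebra.norm_le_one_iff_of_nonneg _ CStarModule.inner_self_nonneg,
        ← CStarModule.norm_sq_eq] at hV ⊢
      exact (pow_le_pow_left₀ (norm_nonneg _) (h _) 2).trans hV
    rw [map_smul, CStarModule.inner_op_smul_left, CStarModule.inner_op_smul_right] at hU
    have h2 := star_right_conjugate_le_conjugate hU (d : A)
    rw [hbs, hs, mul_one, hss] at h2
    convert h2 using 1
    rw [← mul_assoc, ← mul_assoc, hdb, one_mul, mul_assoc, hbd, mul_one]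
  have ht : Filter.Tendsto (fun ε : ℝ => ⟪V x, V x⟫_A + algebraMap ℝ A ε)
      (nhdsWithin 0 (Set.Ioi 0)) (nhds ⟪V x, V x⟫_A) := by
    have h1 : Continuous fun ε : ℝ => ⟪V x, V x⟫_A + algebraMap ℝ A ε := by fun_prop
    have h2 := h1.tendsto 0
    rw [map_zero, add_zero] at h2
    exact h2.mono_left nhdsWithin_le_nhds
  refine ge_of_tendsto ht ?_
  filter_upwards [self_mem_nhdsWithin] with ε hε using key ε hε

theorem LinearMap.smul_inner_self_le_of_norm_le (U V : E →ₗ[A] E) {c : ℝ} (hc : 0 ≤ c)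
    (h : ∀ x, c * ‖U x‖ ≤ ‖V x‖) (x : E) : c ^ 2 • ⟪U x, U x⟫_A ≤ ⟪V x, V x⟫_A := by
  let U' : E →ₗ[A] E :=
    { toFun := fun x => (c : ℂ) • U x
      map_add' := fun x y => by simp
      map_smul' := fun a x => by simp [smul_algebra_smul_comm] }
  have h1 := U'.inner_self_le_of_norm_le V (fun x => by
    change ‖(c : ℂ) • U x‖ ≤ _
    rw [norm_smul, Complex.norm_real, Real.norm_of_nonneg hc]
    exact h x) x
  change ⟪(c : ℂ) • U x, (c : ℂ) • U x⟫_A ≤ _ at h1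
  rw [CStarModule.inner_smul_left_complex, CStarModule.inner_smul_right_complex, smul_smul,
    RCLike.star_def, Complex.conj_ofReal, ← Complex.ofReal_mul, Complex.coe_smul, ← sq] at h1
  exact h1

/-- The Lax–Milgram theorem for symmetric operators on Hilbert modules. -/
theorem exists_inverse_of_coercive [CompleteSpace E] (S : E →L[A] E)
    (hS : ∀ x y, ⟪S x, y⟫_A = ⟪x, S y⟫_A) {c : ℝ} (hc : 0 < c)
    (h : ∀ x, c • ⟪x, x⟫_A ≤ ⟪x, S x⟫_A) :
    ∃ R : E →L[A] E, (∀ x, S (R x) = x) ∧ ∀ x, R (S x) = x := by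
  set Sc : E →L[ℂ] E := S.restrictScalars ℂ with hSc
  set M : ℝ := ‖Sc‖ + 2 * c with hM
  have hM0 : 0 < M := by positivity
  set r : ℝ := c / M ^ 2 with hr
  have hr0 : 0 < r := by positivity
  -- For this `r` the operator `1 - r S` is a strict contraction.
  set q : ℝ := 1 - c ^ 2 / M ^ 2 with hq
  have hq1 : q < 1 := by rw [hq]; linarith [show 0 < c ^ 2 / M ^ 2 by positivity]
  have hMc : 2 * c ≤ M := by rw [hM]; linarith [norm_nonneg Sc]
  have hcM : c ^ 2 / M ^ 2 ≤ 1 / 4 := by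
    rw [div_le_iff₀ (by positivity)]
    nlinarith
  have hq0 : 0 ≤ q := by rw [hq]; linarith
  have hrc : r * c = c ^ 2 / M ^ 2 := by rw [hr]; ring
  have hrM : r ^ 2 * M ^ 2 = c ^ 2 / M ^ 2 := by rw [hr]; field_simp
  set N : E →L[ℂ] E := 1 - (r : ℂ) • Sc with hN
  have hNx : ∀ x, ‖N x‖ ≤ √q * ‖x‖ := by
    intro x
    refine le_of_sq_le_sq ?_ (by positivity)
    rw [mul_pow, Real.sq_sqrt hq0, CStarModule.norm_sq_eq A]
    have h1 : ⟪N x, N x⟫_A ≤ (1 - 2 * (r * c)) • ⟪x, x⟫_A + r ^ 2 • ⟪S x, S x⟫_A := by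
      have hN' : N x = x - (r : ℂ) • S x := rfl
      have e1 : ⟪N x, N x⟫_A = ⟪x, x⟫_A - (2 * r) • ⟪x, S x⟫_A + r ^ 2 • ⟪S x, S x⟫_A := by
        rw [hN']
        simp only [CStarModule.inner_sub_left, CStarModule.inner_sub_right,
          CStarModule.inner_smul_left_complex, CStarModule.inner_smul_right_complex, hS x x,
          RCLike.star_def, Complex.conj_ofReal]
        simp only [Complex.coe_smul]
        module
      rw [e1]
      gcongr ?_ + _
      have h2 := smul_le_smul_of_nonneg_left (h x) (show 0 ≤ 2 * r by positivity)
      calc _ ≤ ⟪x, x⟫_A - (2 * r) • c • ⟪x, x⟫_A := by gcongr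
        _ = _ := by module
    have h2 := CStarAlgebra.norm_le_norm_of_nonneg_of_le CStarModule.inner_self_nonneg h1
    refine h2.trans ((norm_add_le _ _).trans ?_)
    rw [norm_smul, norm_smul, ← CStarModule.norm_sq_eq, ← CStarModule.norm_sq_eq,
      Real.norm_of_nonneg (by linarith), Real.norm_of_nonneg (by positivity)]
    have h3 : ‖S x‖ ≤ M * ‖x‖ := (Sc.le_opNorm x).trans (by gcongr; linarith)
    calc _ ≤ (1 - 2 * (r * c)) * ‖x‖ ^ 2 + r ^ 2 * (M * ‖x‖) ^ 2 := by gcongr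
      _ = (1 - 2 * (r * c) + r ^ 2 * M ^ 2) * ‖x‖ ^ 2 := by ring
      _ = q * ‖x‖ ^ 2 := by rw [hrc, hrM, hq]; ring
  have hN1 : ‖N‖ < 1 := by
    refine lt_of_le_of_lt (N.opNorm_le_bound (Real.sqrt_nonneg q) hNx) ?_
    rw [Real.sqrt_lt' one_pos]
    simpa using hq1
  set U := Units.oneSub N hN1
  have hU : (U : E →L[ℂ] E) = (r : ℂ) • Sc := by
    change 1 - N = _
    rw [hN, sub_sub_cancel]
  set R : E →L[ℂ] E := (r : ℂ) • (↑U⁻¹ : E →L[ℂ] E) with hR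
  have hSR : ∀ x, S (R x) = x := by
    intro x
    have h1 : (U : E →L[ℂ] E) ((↑U⁻¹ : E →L[ℂ] E) x) = x := by
      rw [← mul_apply_eq_comp, U.mul_inv, one_apply_eq_self]
    rw [hU] at h1
    rw [hR]
    change Sc ((r : ℂ) • (↑U⁻¹ : E →L[ℂ] E) x) = x
    rw [map_smul]
    exact h1
  have hRS : ∀ x, R (S x) = x := by
    intro x
    have h1 : (↑U⁻¹ : E →L[ℂ] E) ((U : E →L[ℂ] E) x) = x := by
      rw [← mul_apply_eq_comp, U.inv_mul, one_apply_eq_self]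
    rw [hU] at h1
    change (↑U⁻¹ : E →L[ℂ] E) ((r : ℂ) • Sc x) = x at h1
    rwa [map_smul] at h1
  refine ⟨⟨⟨⟨R, map_add R⟩, fun a x => ?_⟩, R.cont⟩, hSR, hRS⟩
  calc R (a • x) = R (a • S (R x)) := by rw [hSR]
    _ = R (S (a • R x)) := by rw [map_smul S]
    _ = a • R x := hRS _

theorem mem_orthogonalComplement_range_iff {F G : E →L[A] E}
    (hFG : ∀ x y, ⟪F x, y⟫_A = ⟪x, G y⟫_A) (y : E) :
    y ∈ orthogonalComplement (LinearMap.range F.toLinearMap) ↔ G y = 0 := by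
  refine ⟨fun h => ?_, fun h => ?_⟩
  · have h1 : ⟪F (G y), y⟫_A = 0 := h _ ⟨G y, rfl⟩
    rw [hFG] at h1
    exact CStarModule.inner_self.1 h1
  · rintro _ ⟨x, rfl⟩
    change ⟪F x, y⟫_A = 0
    rw [hFG, h, CStarModule.inner_zero_right]

end HilbertModule

/-! ### Generalized limits of bounded sequences in a W⋆-algebra -/

section GeneralizedLimit

open Filter Topology BoundedContinuousFunction

variable {A : Type*} [CStarAlgebra A]

/-- A generalized limit: a contractive linear map from the bounded sequences in `A` to `A` which
sends constant sequences to their value and ignores finitely many terms of a sequence. -/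
structure IsGeneralizedLimit (Λ : (ℕ →ᵇ A) →ₗ[ℂ] A) : Prop where
  norm_le : ∀ z r, (∀ k, ‖z k‖ ≤ r) → ‖Λ z‖ ≤ r
  map_const : ∀ a, Λ (const ℕ a) = a
  map_eq_zero : ∀ z N, (∀ k ≥ N, z k = 0) → Λ z = 0

variable (A) in
/-- In a W⋆-algebra, the weak-⋆ limit along a free ultrafilter is a generalized limit. -/
theorem WStarAlgebra.exists_isGeneralizedLimit [WStarAlgebra A] :
    ∃ Λ : (ℕ →ᵇ A) →ₗ[ℂ] A, IsGeneralizedLimit Λ := by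
  obtain ⟨X, _, _, _, ⟨e⟩⟩ := WStarAlgebra.exists_predual (M := A)
  let U : Filter ℕ := ↑(hyperfilter ℕ)
  have hbound : ∀ (z : ℕ →ᵇ A) (r : ℝ), (∀ k, ‖z k‖ ≤ r) → ∀ k x,
      ‖e.symm (z k) x‖ ≤ r * ‖x‖ := by
    intro z r hz k x
    refine ((e.symm (z k)).le_opNorm x).trans ?_
    rw [e.symm.norm_map]
    gcongr
    exact hz k
  have hlim : ∀ (z : ℕ →ᵇ A) (x : X), Tendsto (fun k => e.symm (z k) x) U
      (𝓝 (limUnder U fun k => e.symm (z k) x)) := by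
    intro z x
    refine tendsto_nhds_limUnder ?_
    obtain ⟨y, -, hy⟩ := (isCompact_closedBall (0 : ℂ) (‖z‖ * ‖x‖)).ultrafilter_le_nhds
      ((hyperfilter ℕ).map fun k => e.symm (z k) x) (by
        rw [Filter.le_principal_iff]
        refine Filter.mem_map.2 (Filter.univ_mem' fun k => ?_)
        simpa using hbound z ‖z‖ (fun k => z.norm_coe_le_norm k) k x)
    exact ⟨y, hy⟩
  have hle : ∀ (z : ℕ →ᵇ A) (r : ℝ), (∀ k, ‖z k‖ ≤ r) → ∀ x,
      ‖limUnder U fun k => e.symm (z k) x‖ ≤ r * ‖x‖ := fun z r hz x =>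
    le_of_tendsto (hlim z x).norm (Eventually.of_forall fun k => hbound z r hz k x)
  let ℓ : (ℕ →ᵇ A) → StrongDual ℂ X := fun z => LinearMap.mkContinuous
    { toFun := fun x => limUnder U fun k => e.symm (z k) x
      map_add' := fun x y => tendsto_nhds_unique (hlim z (x + y)) (by
        simpa using (hlim z x).add (hlim z y))
      map_smul' := fun c x => tendsto_nhds_unique (hlim z (c • x)) (by
        simpa using (hlim z x).const_mul c) } ‖z‖
      (hle z ‖z‖ fun k => z.norm_coe_le_norm k)
  have hℓ : ∀ z x, ℓ z x = limUnder U fun k => e.symm (z k) x := fun z x => rfl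
  have hadd : ∀ z w, ℓ (z + w) = ℓ z + ℓ w := fun z w => by
    ext x
    refine tendsto_nhds_unique (hlim (z + w) x) ?_
    simpa [hℓ] using (hlim z x).add (hlim w x)
  have hsmul : ∀ (c : ℂ) z, ℓ (c • z) = star c • ℓ z := fun c z => by
    ext x
    refine tendsto_nhds_unique (hlim (c • z) x) ?_
    simpa [hℓ, map_smulₛₗ] using (hlim z x).const_mul (star c)
  refine ⟨{ toFun := fun z => e (ℓ z), map_add' := ?_, map_smul' := ?_ }, ?_, ?_, ?_⟩
  · intro z w
    rw [hadd, map_add]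
  · intro c z
    simp [hsmul, map_smulₛₗ]
  · intro z r hz
    change ‖e (ℓ z)‖ ≤ r
    rw [e.norm_map]
    exact ContinuousLinearMap.opNorm_le_bound _ ((norm_nonneg _).trans (hz 0)) (hle z r hz)
  · intro a
    change e (ℓ _) = a
    rw [← e.apply_symm_apply a]
    congr 1
    ext x
    exact tendsto_nhds_unique (hlim _ x) (by simp)
  · intro z N hz
    change e (ℓ z) = 0
    rw [← map_zero e]
    congr 1
    ext x
    refine tendsto_nhds_unique (hlim z x) (tendsto_const_nhds.congr' ?_)
    have h1 : ∀ᶠ k in U, N ≤ k :=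
      Nat.hyperfilter_le_atTop (eventually_ge_atTop N)
    filter_upwards [h1] with k hk
    simp [hz k hk]

end GeneralizedLimit

/-! ### Order properties of generalized limits -/

theorem le_zero_of_forall_le_algebraMap {A : Type*} [CStarAlgebra A] [PartialOrder A]
    [StarOrderedRing A] {b : A}
    (h : ∀ ε : ℝ, 0 < ε → b ≤ algebraMap ℝ A ε) : b ≤ 0 := by
  have ht : Filter.Tendsto (fun ε : ℝ => algebraMap ℝ A ε) (nhdsWithin 0 (Set.Ioi 0)) (nhds 0) := by
    have h2 := (continuous_algebraMap ℝ A).tendsto 0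
    rw [map_zero] at h2
    exact h2.mono_left nhdsWithin_le_nhds
  refine ge_of_tendsto ht ?_
  filter_upwards [self_mem_nhdsWithin] with ε hε using h ε hε

namespace IsGeneralizedLimit

open Filter Topology BoundedContinuousFunction ComplexStarModule

variable {A : Type*} [CStarAlgebra A] [PartialOrder A] [StarOrderedRing A]
  {Λ : (ℕ →ᵇ A) →ₗ[ℂ] A}

/-- `‖z k + i n‖² ≤ ‖z‖² + n²` for self-adjoint `z k`, and this bound passes to the limit. -/
theorem norm_imaginaryPart_add_le (hΛ : IsGeneralizedLimit Λ) (z : ℕ →ᵇ A)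
    (hz : ∀ k, IsSelfAdjoint (z k)) (n : ℝ) :
    ‖(ℑ (Λ z) : A) + algebraMap ℝ A n‖ ≤ √(‖z‖ ^ 2 + n ^ 2) := by
  have h1 : ‖Λ z + (n * Complex.I) • (1 : A)‖ ≤ √(‖z‖ ^ 2 + n ^ 2) := by
    have e1 : Λ z + (n * Complex.I) • (1 : A) = Λ (z + const ℕ ((n * Complex.I) • (1 : A))) := by
      rw [map_add, hΛ.map_const]
    rw [e1]
    refine hΛ.norm_le _ _ fun k => ?_
    refine Real.le_sqrt_of_sq_le ?_
    rw [sq, ← CStarRing.norm_star_mul_self]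
    have e2 : star ((z + const ℕ ((n * Complex.I) • (1 : A))) k) *
        (z + const ℕ ((n * Complex.I) • (1 : A))) k = z k * z k + ((n ^ 2 : ℝ) : ℂ) • (1 : A) := by
      simp only [BoundedContinuousFunction.add_apply, const_apply, star_add, star_smul, star_one,
        (hz k).star_eq, add_mul, mul_add, smul_mul_assoc, mul_smul_comm, one_mul, mul_one,
        star_mul', RCLike.star_def, Complex.conj_ofReal, Complex.conj_I]
      have e3 : (n : ℂ) * Complex.I * (n * -Complex.I) = ((n ^ 2 : ℝ) : ℂ) := by
        push_cast
        linear_combination (-(n : ℂ) ^ 2) * Complex.I_sq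
      rw [← e3]
      module
    rw [e2]
    rcases subsingleton_or_nontrivial A with hA | hA
    · rw [Subsingleton.elim (z k * z k + _) 0, norm_zero]
      positivity
    refine (norm_add_le _ _).trans ?_
    rw [norm_smul, norm_one, mul_one, Complex.norm_real, Real.norm_of_nonneg (sq_nonneg n), sq ‖z‖]
    gcongr
    refine (norm_mul_le _ _).trans ?_
    gcongr <;> exact z.norm_coe_le_norm k
  have h2 : (ℑ (Λ z) : A) + algebraMap ℝ A n = ℑ (Λ z + (n * Complex.I) • (1 : A)) := by
    rw [map_add, AddSubgroup.coe_add]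
    congr 1
    rw [imaginaryPart_apply_coe, Algebra.algebraMap_eq_smul_one]
    simp only [star_smul, star_one, star_mul', RCLike.star_def, Complex.conj_ofReal,
      Complex.conj_I]
    rw [← sub_smul, ← Complex.coe_smul n, ← Complex.coe_smul (2⁻¹ : ℝ), smul_smul, smul_smul]
    congr 1
    push_cast
    linear_combination (n : ℂ) * Complex.I_sq
  rw [h2]
  refine le_trans ?_ h1
  exact imaginaryPart.norm_le (Λ z + (n * Complex.I) • (1 : A))

/-- Generalized limits of self-adjoint sequences are self-adjoint: an imaginary part `b` would
make `‖b + n‖` larger than `√(‖z‖² + n²)` for a large real `n` of suitable sign. -/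
theorem isSelfAdjoint (hΛ : IsGeneralizedLimit Λ) (z : ℕ →ᵇ A)
    (hz : ∀ k, IsSelfAdjoint (z k)) : IsSelfAdjoint (Λ z) := by
  have key : ∀ w : ℕ →ᵇ A, (∀ k, IsSelfAdjoint (w k)) → (ℑ (Λ w) : A) ≤ 0 := by
    intro w hw
    refine le_zero_of_forall_le_algebraMap fun ε hε => ?_
    set n : ℝ := ‖w‖ ^ 2 / (2 * ε)
    have h1 := hΛ.norm_imaginaryPart_add_le w hw n
    have h2 : √(‖w‖ ^ 2 + n ^ 2) ≤ n + ε := by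
      refine Real.sqrt_le_iff.2 ⟨by positivity, ?_⟩
      have h3 : 2 * ε * n = ‖w‖ ^ 2 := by
        simp only [n]
        field_simp
      nlinarith
    have h4 : IsSelfAdjoint ((ℑ (Λ w) : A) + algebraMap ℝ A n) :=
      (ℑ (Λ w)).2.add (IsSelfAdjoint.algebraMap A (IsSelfAdjoint.all n))
    have h5 := h4.le_algebraMap_norm_self.trans
      (algebraMap_mono A (h1.trans h2))
    rw [map_add, add_comm] at h5
    exact le_of_add_le_add_left h5
  have h1 := key z hz
  have h2 := key (-z) fun k => (hz k).neg
  rw [map_neg, map_neg, AddSubgroup.coe_neg, neg_nonpos] at h2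
  have h3 : ℑ (Λ z) = 0 := Subtype.ext (le_antisymm h1 h2)
  exact imaginaryPart_eq_zero_iff.1 h3

/-- The condition `‖r - z‖ ≤ r` with `r = ‖z‖` passes to the limit and characterizes positivity of
self-adjoint elements. -/
theorem nonneg (hΛ : IsGeneralizedLimit Λ) (z : ℕ →ᵇ A) (hz : ∀ k, 0 ≤ z k) : 0 ≤ Λ z := by
  have hsa := hΛ.isSelfAdjoint z fun k => IsSelfAdjoint.of_nonneg (hz k)
  have h1 : ‖algebraMap ℝ A ‖z‖ - Λ z‖ ≤ ‖z‖ := by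
    have e1 : algebraMap ℝ A ‖z‖ - Λ z = Λ (const ℕ (algebraMap ℝ A ‖z‖) - z) := by
      rw [map_sub, hΛ.map_const]
    rw [e1]
    refine hΛ.norm_le _ _ fun k => ?_
    have h2 : z k ≤ algebraMap ℝ A ‖z‖ :=
      (CStarAlgebra.norm_le_iff_le_algebraMap _ (norm_nonneg _) (hz k)).1 (z.norm_coe_le_norm k)
    refine (CStarAlgebra.norm_le_iff_le_algebraMap _ (norm_nonneg _) ?_).2 ?_
    · simpa using h2
    · simpa using hz k
  have h2 : IsSelfAdjoint (algebraMap ℝ A ‖z‖ - Λ z) :=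
    (IsSelfAdjoint.algebraMap A (IsSelfAdjoint.all ‖z‖)).sub hsa
  have h3 := h2.le_algebraMap_norm_self.trans (algebraMap_mono A h1)
  simpa using h3

theorem nonneg_of_eventually (hΛ : IsGeneralizedLimit Λ) (z : ℕ →ᵇ A) (N : ℕ)
    (hz : ∀ k ≥ N, 0 ≤ z k) : 0 ≤ Λ z := by
  let y : ℕ →ᵇ A := ofNormedAddCommGroupDiscrete (fun k => if k < N then 0 else z k) ‖z‖ fun k => by
    split_ifs
    · simp
    · exact z.norm_coe_le_norm k
  have hy : ∀ k, y k = if k < N then 0 else z k := fun k => rfl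
  have h1 : Λ (z - y) = 0 := hΛ.map_eq_zero _ N fun k hk => by simp [hy, not_lt.2 hk]
  rw [map_sub, sub_eq_zero] at h1
  rw [h1]
  refine hΛ.nonneg y fun k => ?_
  rw [hy]
  split_ifs with h
  · exact le_rfl
  · exact hz k (not_lt.1 h)

/-- The limit of an antitone sequence is its infimum. -/
theorem isGLB (hΛ : IsGeneralizedLimit Λ) (z : ℕ →ᵇ A) (hz : Antitone z) :
    IsGLB (Set.range z) (Λ z) := by
  refine ⟨?_, fun b hb => ?_⟩
  · rintro _ ⟨N, rfl⟩
    have h := hΛ.nonneg_of_eventually (const ℕ (z N) - z) N fun k hk => by simpa using hz hk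
    rw [map_sub, hΛ.map_const] at h
    exact sub_nonneg.1 h
  · have h := hΛ.nonneg (z - const ℕ b) fun k => by
      simpa using hb ⟨k, rfl⟩
    rw [map_sub, hΛ.map_const] at h
    exact sub_nonneg.1 h

/-- Conjugation by an invertible element is an order isomorphism and preserves infima. -/
theorem map_conj_of_isUnit (hΛ : IsGeneralizedLimit Λ) (z : ℕ →ᵇ A) (hz : Antitone z) {x : A}
    (hx : IsUnit x) : Λ (const ℕ x * z * const ℕ (star x)) = x * Λ z * star x := by
  obtain ⟨u, rfl⟩ := hx
  have h1 := hΛ.isGLB (const ℕ (u : A) * z * const ℕ (star (u : A))) fun k l hkl =>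
    star_right_conjugate_le_conjugate (hz hkl) (u : A)
  refine h1.unique ⟨?_, fun b hb => ?_⟩
  · rintro _ ⟨k, rfl⟩
    exact star_right_conjugate_le_conjugate ((hΛ.isGLB z hz).1 ⟨k, rfl⟩) (u : A)
  · have hs : star (u : A) * star (↑u⁻¹ : A) = 1 := by
      rw [← star_mul, u.inv_mul, star_one]
    have hs' : star (↑u⁻¹ : A) * star (u : A) = 1 := by
      rw [← star_mul, u.mul_inv, star_one]
    have h2 : (↑u⁻¹ : A) * b * star (↑u⁻¹ : A) ≤ Λ z := by
      refine (hΛ.isGLB z hz).2 ?_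
      rintro _ ⟨k, rfl⟩
      have h3 : b ≤ ↑u * z k * star ↑u := hb ⟨k, rfl⟩
      have h4 := star_right_conjugate_le_conjugate h3 (↑u⁻¹ : A)
      rwa [mul_assoc _ (_ * _) (star (↑u⁻¹ : A)), mul_assoc _ (star _) (star _), hs, mul_one,
        ← mul_assoc, u.inv_mul, one_mul] at h4
    have h5 := star_right_conjugate_le_conjugate h2 (u : A)
    rwa [mul_assoc _ (_ * _) (star (u : A)), mul_assoc _ (star _) (star _), hs', mul_one,
      ← mul_assoc, u.mul_inv, one_mul] at h5

/-- Since `Λ` is linear, the case of a general `x` follows from that of the invertible elements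
`t + x` and `t - x`, where `t` is a large scalar. -/
theorem map_conj (hΛ : IsGeneralizedLimit Λ) (z : ℕ →ᵇ A) (hz : Antitone z) (x : A) :
    Λ (const ℕ x * z * const ℕ (star x)) = x * Λ z * star x := by
  rcases subsingleton_or_nontrivial A with hA | hA
  · exact Subsingleton.elim _ _
  set t : ℂ := ((‖x‖ + 1 : ℝ) : ℂ) with ht
  have hts : star t = t := Complex.conj_ofReal _
  have hnt : ‖x‖ < ‖t‖ := by
    rw [ht, Complex.norm_real, Real.norm_of_nonneg (by positivity)]
    linarith
  have h1 : IsUnit (algebraMap ℂ A t - x) := spectrum.mem_resolventSet_of_norm_lt hnt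
  have h2 : IsUnit (algebraMap ℂ A t - -x) :=
    spectrum.mem_resolventSet_of_norm_lt (by rwa [norm_neg])
  have h3 := hΛ.map_conj_of_isUnit z hz h1
  have h4 := hΛ.map_conj_of_isUnit z hz h2
  have e : const ℕ (algebraMap ℂ A t - x) * z * const ℕ (star (algebraMap ℂ A t - x)) +
      const ℕ (algebraMap ℂ A t - -x) * z * const ℕ (star (algebraMap ℂ A t - -x)) =
      (2 * t ^ 2) • z + (2 : ℂ) • (const ℕ x * z * const ℕ (star x)) := by
    ext k
    simp only [Algebra.algebraMap_eq_smul_one, BoundedContinuousFunction.add_apply,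
      BoundedContinuousFunction.mul_apply, const_apply, BoundedContinuousFunction.smul_apply,
      star_sub, star_neg, star_smul, star_one, hts, sub_mul, mul_sub, smul_mul_assoc,
      mul_smul_comm, one_mul, mul_one, neg_mul, mul_neg, smul_sub, smul_neg, smul_smul]
    module
  have h5 := congrArg Λ e
  rw [map_add, h3, h4, map_add, map_smul, map_smul] at h5
  have h6 : (algebraMap ℂ A t - x) * Λ z * star (algebraMap ℂ A t - x) +
      (algebraMap ℂ A t - -x) * Λ z * star (algebraMap ℂ A t - -x) =
      (2 * t ^ 2) • Λ z + (2 : ℂ) • (x * Λ z * star x) := by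
    simp only [Algebra.algebraMap_eq_smul_one,
      star_sub, star_neg, star_smul, star_one, hts, sub_mul, mul_sub, smul_mul_assoc,
      mul_smul_comm, one_mul, mul_one, neg_mul, mul_neg, smul_sub, smul_neg, smul_smul]
    module
  rw [h6] at h5
  exact (smul_right_injective A (two_ne_zero : (2 : ℂ) ≠ 0) (add_left_cancel h5)).symm

/-- Follows from `map_conj` by polarization. -/
theorem map_mul_mul (hΛ : IsGeneralizedLimit Λ) (z : ℕ →ᵇ A) (hz : Antitone z) (x y : A) :
    Λ (const ℕ x * z * const ℕ y) = x * Λ z * y := by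
  have e : ∀ w : A, (4 : ℂ) • (x * w * y) =
      (x + star y) * w * star (x + star y) - (x - star y) * w * star (x - star y) +
      Complex.I • ((x + Complex.I • star y) * w * star (x + Complex.I • star y)) -
      Complex.I • ((x - Complex.I • star y) * w * star (x - Complex.I • star y)) := by
    intro w
    simp only [star_add, star_sub, star_star, star_smul, RCLike.star_def, Complex.conj_I, add_mul,
      mul_add, sub_mul, mul_sub, smul_mul_assoc, mul_smul_comm, smul_add, smul_sub, smul_smul,
      Complex.I_mul_I, mul_neg, neg_mul]
    module
  have e' : (4 : ℂ) • (const ℕ x * z * const ℕ y) =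
      const ℕ (x + star y) * z * const ℕ (star (x + star y)) -
      const ℕ (x - star y) * z * const ℕ (star (x - star y)) +
      Complex.I • (const ℕ (x + Complex.I • star y) * z *
        const ℕ (star (x + Complex.I • star y))) -
      Complex.I • (const ℕ (x - Complex.I • star y) * z *
        const ℕ (star (x - Complex.I • star y))) := by
    ext k
    exact e (z k)
  have h := congrArg Λ e'
  simp only [map_smul, map_sub, map_add] at h
  simp only [hΛ.map_conj z hz] at h
  rw [← e] at h
  exact smul_right_injective A (by norm_num : (4 : ℂ) ≠ 0) h

/-- The sequence with its first term dropped. -/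
def shift (z : ℕ →ᵇ A) : ℕ →ᵇ A :=
  z.compContinuous ⟨(· + 1), continuous_of_discreteTopology⟩

@[simp] theorem shift_apply (z : ℕ →ᵇ A) (k : ℕ) : shift z k = z (k + 1) := rfl

theorem map_shift (hΛ : IsGeneralizedLimit Λ) (z : ℕ →ᵇ A) (hz : Antitone z) :
    Λ (shift z) = Λ z := by
  refine (hΛ.isGLB (shift z) fun k l hkl => hz (Nat.succ_le_succ hkl)).unique ⟨?_, fun b hb => ?_⟩
  · rintro _ ⟨k, rfl⟩
    exact (hΛ.isGLB z hz).1 ⟨k + 1, rfl⟩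
  · refine (hΛ.isGLB z hz).2 ?_
    rintro _ ⟨k, rfl⟩
    exact (hb ⟨k, rfl⟩).trans (hz k.le_succ)

variable (Λ) in
/-- The bounded sequences on which `Λ` is a bimodule map and is invariant under the shift. It is a
subspace which contains the antitone sequences, because `Λ` sends these to their infimum. -/
def regular : Submodule ℂ (ℕ →ᵇ A) where
  carrier := {z | (∀ x y, Λ (const ℕ x * z * const ℕ y) = x * Λ z * y) ∧ Λ (shift z) = Λ z}
  zero_mem' := ⟨fun x y => by simp, by
    have : shift (0 : ℕ →ᵇ A) = 0 := rfl
    rw [this]⟩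
  add_mem' {z w} hz hw := ⟨fun x y => by
      rw [mul_add, add_mul, map_add, hz.1, hw.1, map_add, mul_add, add_mul], by
      have : shift (z + w) = shift z + shift w := rfl
      rw [this, map_add, map_add, hz.2, hw.2]⟩
  smul_mem' c z hz := ⟨fun x y => by
      rw [mul_smul_comm, smul_mul_assoc, map_smul, hz.1, map_smul, mul_smul_comm,
        smul_mul_assoc], by
      have : shift (c • z) = c • shift z := rfl
      rw [this, map_smul, map_smul, hz.2]⟩

theorem mem_regular (hΛ : IsGeneralizedLimit Λ) (z : ℕ →ᵇ A) (hz : Antitone z) :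
    z ∈ regular Λ :=
  ⟨hΛ.map_mul_mul z hz, hΛ.map_shift z hz⟩

end IsGeneralizedLimit

/-! ### Kernels of finitely presented maps over a W⋆-algebra -/

section PowersOfComplement

open BoundedContinuousFunction

variable {A E : Type*} [CStarAlgebra A] [PartialOrder A] [StarOrderedRing A]
  [NormedAddCommGroup E] [NormedSpace ℂ E] [Module A E] [IsScalarTower ℂ A E] [CStarModule A E]

theorem inner_one_sub_pow_left {D : Module.End A E} (hs : ∀ x y, ⟪D x, y⟫_A = ⟪x, D y⟫_A) (k : ℕ)
    (x y : E) : ⟪((1 - D) ^ k) x, y⟫_A = ⟪x, ((1 - D) ^ k) y⟫_A := by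
  induction k generalizing x y with
  | zero => simp
  | succ k ih =>
    rw [pow_succ', Module.End.mul_apply, ← pow_succ', pow_succ, Module.End.mul_apply, ← ih]
    simp [hs]

/-- For even `k = 2j` this is `⟨w, D w⟩` with `w = (1 - D)ʲ x`, for odd `k = 2j + 1` it is
`⟨w, D w⟩ - ⟨D w, D w⟩`. -/
theorem inner_one_sub_pow_nonneg {D : Module.End A E} (hs : ∀ x y, ⟪D x, y⟫_A = ⟪x, D y⟫_A)
    (hD : ∀ x, ⟪D x, D x⟫_A ≤ ⟪x, D x⟫_A) (k : ℕ) (x : E) :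
    0 ≤ ⟪x, ((1 - D) ^ k) (D x)⟫_A := by
  have hcomm : ∀ j : ℕ, Commute ((1 - D) ^ j) D := fun j =>
    ((Commute.one_left D).sub_left (Commute.refl D)).pow_left j
  have hcomm' : ∀ (j : ℕ) (y : E), ((1 - D) ^ j : Module.End A E) (D y) =
      D (((1 - D) ^ j : Module.End A E) y) := fun j y =>
    LinearMap.congr_fun (hcomm j).eq y
  obtain ⟨j, rfl | rfl⟩ := Nat.even_or_odd' k
  · rw [two_mul, pow_add, Module.End.mul_apply, ← inner_one_sub_pow_left hs, hcomm']
    exact CStarModule.inner_self_nonneg.trans (hD _)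
  · rw [pow_succ, two_mul, pow_add, mul_assoc, Module.End.mul_apply, ← inner_one_sub_pow_left hs,
      ← Module.End.mul_apply, mul_assoc]
    have e : ((1 - D) ^ j * ((1 - D) * D)) x =
        D (((1 - D) ^ j) x) - D (D (((1 - D) ^ j) x)) := by
      rw [Module.End.mul_apply, Module.End.mul_apply, LinearMap.sub_apply, Module.End.one_apply,
        map_sub, hcomm', hcomm', hcomm']
    rw [e, CStarModule.inner_sub_right, ← hs _ (D _), sub_nonneg]
    exact hD _

theorem antitone_inner_one_sub_pow {D : Module.End A E}
    (hs : ∀ x y, ⟪D x, y⟫_A = ⟪x, D y⟫_A) (hD : ∀ x, ⟪D x, D x⟫_A ≤ ⟪x, D x⟫_A) (x : E) :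
    Antitone fun k : ℕ => ⟪x, ((1 - D) ^ k : Module.End A E) x⟫_A := by
  refine antitone_nat_of_succ_le fun k => ?_
  rw [pow_succ, Module.End.mul_apply, LinearMap.sub_apply, Module.End.one_apply, map_sub,
    CStarModule.inner_sub_right, sub_le_self_iff]
  exact inner_one_sub_pow_nonneg hs hD k x

theorem norm_one_sub_pow_le {D : Module.End A E}
    (hs : ∀ x y, ⟪D x, y⟫_A = ⟪x, D y⟫_A) (hD : ∀ x, ⟪D x, D x⟫_A ≤ ⟪x, D x⟫_A) (k : ℕ) (x : E) :
    ‖((1 - D) ^ k) x‖ ≤ ‖x‖ := by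
  refine le_of_sq_le_sq ?_ (norm_nonneg _)
  rw [CStarModule.norm_sq_eq A, CStarModule.norm_sq_eq A (x := x)]
  refine CStarAlgebra.norm_le_norm_of_nonneg_of_le CStarModule.inner_self_nonneg ?_
  rw [inner_one_sub_pow_left hs, ← Module.End.mul_apply, ← pow_add]
  simpa using antitone_inner_one_sub_pow hs hD x (Nat.zero_le (k + k))

/-- The bounded sequence of matrix coefficients `⟨x, (1 - D)ᵏ y⟩`. -/
noncomputable def coeffSeq {D : Module.End A E} (hs : ∀ x y, ⟪D x, y⟫_A = ⟪x, D y⟫_A)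
    (hD : ∀ x, ⟪D x, D x⟫_A ≤ ⟪x, D x⟫_A) (x y : E) : ℕ →ᵇ A :=
  ofNormedAddCommGroupDiscrete (fun k => ⟪x, ((1 - D) ^ k) y⟫_A) (‖x‖ * ‖y‖) fun k =>
    (CStarModule.norm_inner_le E).trans (by gcongr; exact norm_one_sub_pow_le hs hD k y)

theorem coeffSeq_apply {D : Module.End A E} (hs : ∀ x y, ⟪D x, y⟫_A = ⟪x, D y⟫_A)
    (hD : ∀ x, ⟪D x, D x⟫_A ≤ ⟪x, D x⟫_A) (x y : E) (k : ℕ) :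
    coeffSeq hs hD x y k = ⟪x, ((1 - D) ^ k) y⟫_A := rfl

/-- By polarization, the matrix coefficients are linear combinations of antitone sequences. -/
theorem coeffSeq_mem_regular {Λ : (ℕ →ᵇ A) →ₗ[ℂ] A} (hΛ : IsGeneralizedLimit Λ)
    {D : Module.End A E} (hs : ∀ x y, ⟪D x, y⟫_A = ⟪x, D y⟫_A)
    (hD : ∀ x, ⟪D x, D x⟫_A ≤ ⟪x, D x⟫_A) (x y : E) :
    coeffSeq hs hD x y ∈ IsGeneralizedLimit.regular Λ := by
  have hd : ∀ u, coeffSeq hs hD u u ∈ IsGeneralizedLimit.regular Λ := fun u =>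
    hΛ.mem_regular _ (antitone_inner_one_sub_pow hs hD u)
  have e : coeffSeq hs hD x y = (4 : ℂ)⁻¹ • (coeffSeq hs hD (y + x) (y + x) -
      coeffSeq hs hD (y - x) (y - x) +
      Complex.I • coeffSeq hs hD (y + Complex.I • x) (y + Complex.I • x) -
      Complex.I • coeffSeq hs hD (y - Complex.I • x) (y - Complex.I • x)) := by
    ext k
    simp only [coeffSeq_apply, BoundedContinuousFunction.smul_apply,
      BoundedContinuousFunction.sub_apply, BoundedContinuousFunction.add_apply, map_add, map_sub,
      LinearMap.map_smul_of_tower, CStarModule.inner_add_left, CStarModule.inner_add_right,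
      CStarModule.inner_sub_left, CStarModule.inner_sub_right, CStarModule.inner_smul_left_complex,
      CStarModule.inner_smul_right_complex, RCLike.star_def, Complex.conj_I, smul_add, smul_sub,
      smul_smul, mul_assoc, Complex.I_mul_I, mul_neg]
    module
  rw [e]
  exact Submodule.smul_mem _ _ (Submodule.sub_mem _ (Submodule.add_mem _
    (Submodule.sub_mem _ (hd _) (hd _)) (Submodule.smul_mem _ _ (hd _)))
    (Submodule.smul_mem _ _ (hd _)))

end PowersOfComplement

namespace StdModule

open BoundedContinuousFunction

variable {A E : Type*} [CStarAlgebra A] [PartialOrder A] [StarOrderedRing A]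
  [NormedAddCommGroup E] [NormedSpace ℂ E] [Module A E] [IsScalarTower ℂ A E] [CStarModule A E]

theorem mem_range_trunc_iff {m : ℕ} {x : StdModule A} :
    x ∈ LinearMap.range (trunc (A := A) m).toLinearMap ↔ trunc m x = x := by
  refine ⟨?_, fun h => ⟨x, h⟩⟩
  rintro ⟨y, rfl⟩
  exact trunc_trunc m y

/-- For `D = G⋆G` on `Aᵐ`, the generalized limit of the matrices `(1 - D)ᵏ` is a matrix whose rows
generate the kernel of `G`. -/
theorem fg_ker_inf_range_trunc_of_norm_le [WStarAlgebra A] (G : StdModule A →ₗ[A] E) (m : ℕ)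
    (hG : ∑ i ∈ Finset.range m, ‖G (basisVec i)‖ ^ 2 ≤ 1) :
    (LinearMap.ker G ⊓ LinearMap.range (trunc (A := A) m).toLinearMap).FG := by
  obtain ⟨Λ, hΛ⟩ := WStarAlgebra.exists_isGeneralizedLimit A
  set u : ℕ → E := fun i => G (basisVec i) with hu
  have hGt : ∀ x, G (trunc m x) = ∑ i ∈ Finset.range m, x.coord i • u i := fun x => by
    simp [trunc_apply, hu]
  let D : Module.End A (StdModule A) :=
    { toFun := fun x => ∑ i ∈ Finset.range m, ⟪u i, G (trunc m x)⟫_A • basisVec i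
      map_add' := fun x y => by simp [add_smul, Finset.sum_add_distrib]
      map_smul' := fun a x => by simp [mul_smul, Finset.smul_sum] }
  have hDdef : ∀ x, D x = ∑ i ∈ Finset.range m, ⟪u i, G (trunc m x)⟫_A • basisVec i :=
    fun x => rfl
  have hDc : ∀ x l, (D x).coord l = if l < m then ⟪u l, G (trunc m x)⟫_A else 0 := fun x l => by
    simp [hDdef, coord_basisVec]
  have hinner_basis : ∀ (x : StdModule A) i, ⟪x, basisVec i⟫_A = star (x.coord i) := fun x i => by
    rw [← CStarModule.star_inner, inner_basisVec]
  have hxD : ∀ x y, ⟪x, D y⟫_A = ⟪G (trunc m x), G (trunc m y)⟫_A := fun x y => by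
    rw [hDdef, hGt x, CStarModule.inner_sum_right, CStarModule.inner_sum_left]
    simp [hinner_basis]
  have hs : ∀ x y, ⟪D x, y⟫_A = ⟪x, D y⟫_A := fun x y => by
    rw [← CStarModule.star_inner, hxD, CStarModule.star_inner, ← hxD]
  have hD : ∀ x, ⟪D x, D x⟫_A ≤ ⟪x, D x⟫_A := fun x => by
    set v := G (trunc m x) with hv
    calc ⟪D x, D x⟫_A = ∑ i ∈ Finset.range m, ⟪u i, v⟫_A * ⟪v, u i⟫_A := by
          nth_rw 2 [hDdef]
          rw [CStarModule.inner_sum_right]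
          refine Finset.sum_congr rfl fun i hi => ?_
          rw [CStarModule.inner_op_smul_right, hinner_basis, hDc, if_pos (Finset.mem_range.1 hi),
            CStarModule.star_inner]
      _ ≤ ∑ i ∈ Finset.range m, ‖u i‖ ^ 2 • ⟪v, v⟫_A :=
          Finset.sum_le_sum fun i _ => CStarModule.inner_mul_inner_swap_le
      _ = (∑ i ∈ Finset.range m, ‖u i‖ ^ 2) • ⟪v, v⟫_A := by rw [Finset.sum_smul]
      _ ≤ (1 : ℝ) • ⟪v, v⟫_A := smul_le_smul_of_nonneg_right hG CStarModule.inner_self_nonneg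
      _ = ⟪x, D x⟫_A := by rw [one_smul, hxD]
  have hDt : ∀ x, D x = ∑ j ∈ Finset.range m, x.coord j • D (basisVec j) := fun x => by
    have h1 : D x = D (trunc m x) := by
      rw [hDdef, hDdef, trunc_trunc]
    rw [h1, trunc_apply, map_sum]
    simp
  have hker : ∀ x, D x = 0 → G (trunc m x) = 0 := fun x hx => by
    have := hxD x x
    rw [hx, CStarModule.inner_zero_right] at this
    exact CStarModule.inner_self.1 this.symm
  set z : ℕ → ℕ → ℕ →ᵇ A := fun j i => coeffSeq hs hD (basisVec j) (basisVec i) with hz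
  have hzk : ∀ j i k, z j i k = (((1 - D) ^ k) (basisVec i)).coord j := fun j i k => by
    rw [hz, coeffSeq_apply, inner_basisVec]
  have hreg : ∀ j i, z j i ∈ IsGeneralizedLimit.regular Λ := fun j i =>
    coeffSeq_mem_regular hΛ hs hD _ _
  set r : ℕ → StdModule A := fun i => ∑ j ∈ Finset.range m, Λ (z j i) • basisVec j with hr
  have hrc : ∀ i l, (r i).coord l = if l < m then Λ (z l i) else 0 := fun i l => by
    simp [hr, coord_basisVec]
  -- `(1 - D)ᵏ D` is a difference of consecutive powers, so the generalized limit kills it.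
  have hDr : ∀ i, D (r i) = 0 := fun i => by
    ext l
    rw [hDt, coord_sum, coord_zero]
    have h1 : ∀ j ∈ Finset.range m, ((r i).coord j • D (basisVec j)).coord l =
        Λ (const ℕ 1 * z j i * const ℕ ((D (basisVec j)).coord l)) := fun j hj => by
      rw [(hreg j i).1, one_mul, coord_smul, hrc, if_pos (Finset.mem_range.1 hj)]
    rw [Finset.sum_congr rfl h1, ← map_sum]
    have h2 : ∑ j ∈ Finset.range m, const ℕ 1 * z j i * const ℕ ((D (basisVec j)).coord l) =
        z l i - IsGeneralizedLimit.shift (z l i) := by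
      ext k
      simp only [BoundedContinuousFunction.coe_sum, Finset.sum_apply,
        BoundedContinuousFunction.mul_apply, const_apply, one_mul,
        BoundedContinuousFunction.sub_apply, IsGeneralizedLimit.shift_apply, hzk]
      rw [pow_succ', Module.End.mul_apply, LinearMap.sub_apply, Module.End.one_apply, coord_sub,
        sub_sub_cancel, hDt, coord_sum]
      rfl
    rw [h2, map_sub, (hreg l i).2, sub_self]
  have hrt : ∀ i, trunc m (r i) = r i := fun i => by
    ext l
    rw [coord_trunc, hrc]
    split_ifs <;> rfl
  classical
  refine ⟨(Finset.range m).image r, le_antisymm ?_ ?_⟩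
  · rw [Submodule.span_le]
    intro y hy
    obtain ⟨i, -, rfl⟩ := Finset.mem_image.1 (Finset.mem_coe.1 hy)
    refine ⟨?_, mem_range_trunc_iff.2 (hrt i)⟩
    have := hker _ (hDr i)
    rwa [hrt] at this
  · rintro x ⟨hx1, hx2'⟩
    have hx2 := mem_range_trunc_iff.1 hx2'
    have hGx : G x = 0 := hx1
    have hDx : D x = 0 := by
      rw [hDdef]
      simp [hx2, hGx]
    have hpow : ∀ k : ℕ, ((1 - D) ^ k : Module.End A (StdModule A)) x = x := fun k => by
      induction k with
      | zero => rfl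
      | succ k ih => rw [pow_succ, Module.End.mul_apply, LinearMap.sub_apply, hDx, sub_zero,
          Module.End.one_apply, ih]
    have hxr : x = ∑ i ∈ Finset.range m, x.coord i • r i := by
      ext j
      rw [coord_sum]
      by_cases hj : j < m
      · have h1 : const ℕ (x.coord j) =
            ∑ i ∈ Finset.range m, const ℕ (x.coord i) * z j i * const ℕ 1 := by
          ext k
          simp only [BoundedContinuousFunction.coe_sum, Finset.sum_apply,
            BoundedContinuousFunction.mul_apply, const_apply, mul_one, hzk]
          conv_lhs => rw [← hpow k, ← hx2, trunc_apply, map_sum, coord_sum]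
          simp
        rw [← hΛ.map_const (x.coord j), h1, map_sum]
        refine Finset.sum_congr rfl fun i _ => ?_
        rw [(hreg j i).1, mul_one, coord_smul, hrc, if_pos hj]
      · have h1 : x.coord j = 0 := by rw [← hx2, coord_trunc, if_neg hj]
        rw [h1, Finset.sum_eq_zero]
        intro i _
        rw [coord_smul, hrc, if_neg hj, mul_zero]
    rw [hxr]
    exact Submodule.sum_mem _ fun i hi => Submodule.smul_mem _ _
      (Submodule.subset_span (Finset.mem_coe.2 (Finset.mem_image_of_mem r hi)))

/-- Over a W⋆-algebra, the kernel of an `A`-linear map from `Aᵐ` to a Hilbert module is finitely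
generated. -/
theorem fg_ker_inf_range_trunc [WStarAlgebra A] (G : StdModule A →ₗ[A] E) (m : ℕ) :
    (LinearMap.ker G ⊓ LinearMap.range (trunc (A := A) m).toLinearMap).FG := by
  set s : ℝ := ∑ i ∈ Finset.range m, ‖G (basisVec i)‖ ^ 2 with hs
  have hs0 : 0 ≤ s := Finset.sum_nonneg fun i _ => sq_nonneg _
  set t : ℝ := 1 / (s + 1) with ht
  have ht0 : 0 < t := by positivity
  let G' : StdModule A →ₗ[A] E :=
    { toFun := fun x => (t : ℂ) • G x
      map_add' := fun x y => by simp
      map_smul' := fun a x => by simp [smul_algebra_smul_comm] }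
  have hG' : ∀ x, G' x = (t : ℂ) • G x := fun x => rfl
  have hker : LinearMap.ker G' = LinearMap.ker G := by
    ext x
    simp [hG', ht0.ne']
  rw [← hker]
  refine fg_ker_inf_range_trunc_of_norm_le G' m ?_
  simp only [hG', norm_smul, mul_pow, ← Finset.mul_sum, Complex.norm_real,
    Real.norm_of_nonneg ht0.le]
  rw [← hs, ht, one_div, inv_pow, inv_mul_le_one₀ (by positivity)]
  nlinarith

end StdModule

/-! ### Operators bounded below on a tail of the standard module -/

namespace StdModule

open Filter Topology

variable {A : Type*} [CStarAlgebra A] [PartialOrder A] [StarOrderedRing A]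

/-- The projection `1 - P n` onto the coordinates from the `n`-th on. -/
noncomputable def tail (n : ℕ) : StdModule A →L[A] StdModule A :=
  ContinuousLinearMap.id A _ - trunc n

theorem tail_apply (n : ℕ) (x : StdModule A) : tail n x = x - trunc n x := rfl

theorem coord_tail (n : ℕ) (x : StdModule A) (j : ℕ) :
    (tail n x).coord j = if j < n then 0 else x.coord j := by
  rw [tail_apply, coord_sub, coord_trunc]
  split_ifs <;> simp

@[simp] theorem trunc_tail (n : ℕ) (x : StdModule A) : trunc n (tail n x) = 0 := by
  rw [tail_apply, map_sub, trunc_trunc, sub_self]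

theorem tail_tail_of_le {m n : ℕ} (h : m ≤ n) (x : StdModule A) :
    tail m (tail n x) = tail n x := by
  ext j
  simp only [coord_tail]
  split_ifs <;> first | rfl | omega

@[simp] theorem tail_tail (n : ℕ) (x : StdModule A) : tail n (tail n x) = tail n x :=
  tail_tail_of_le le_rfl x

@[simp] theorem tail_trunc (n : ℕ) (x : StdModule A) : tail n (trunc n x) = 0 := by
  rw [tail_apply, trunc_trunc, sub_self]

theorem trunc_add_tail (n : ℕ) (x : StdModule A) : trunc n x + tail n x = x := by
  rw [tail_apply, add_sub_cancel]

theorem inner_tail_left (n : ℕ) (x y : StdModule A) :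
    ⟪tail n x, y⟫_A = ⟪x, tail n y⟫_A := by
  rw [tail_apply, tail_apply, CStarModule.inner_sub_left, CStarModule.inner_sub_right,
    inner_trunc_left]

theorem inner_self_eq_add (n : ℕ) (x : StdModule A) :
    ⟪x, x⟫_A = ⟪tail n x, tail n x⟫_A + ⟪trunc n x, trunc n x⟫_A := by
  rw [inner_tail_left, inner_trunc_left, tail_tail, trunc_trunc, ← CStarModule.inner_add_right,
    add_comm, trunc_add_tail]

theorem norm_tail_le (n : ℕ) (x : StdModule A) : ‖tail n x‖ ≤ ‖x‖ := by
  refine le_of_sq_le_sq ?_ (norm_nonneg _)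
  rw [CStarModule.norm_sq_eq A, CStarModule.norm_sq_eq A (x := x)]
  refine CStarAlgebra.norm_le_norm_of_nonneg_of_le CStarModule.inner_self_nonneg ?_
  rw [inner_self_eq_add n x]
  exact le_add_of_nonneg_right CStarModule.inner_self_nonneg

theorem tendsto_tail (x : StdModule A) : Tendsto (fun n => tail n x) atTop (𝓝 0) :=
  tendsto_sub_trunc x

theorem fg_range_trunc (n : ℕ) : (LinearMap.range (trunc (A := A) n).toLinearMap).FG := by
  classical
  refine ⟨(Finset.range n).image basisVec, le_antisymm ?_ ?_⟩
  · rw [Submodule.span_le]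
    intro y hy
    obtain ⟨i, hi, rfl⟩ := Finset.mem_image.1 (Finset.mem_coe.1 hy)
    refine mem_range_trunc_iff.2 ?_
    ext j
    have := Finset.mem_range.1 hi
    rw [coord_trunc, coord_basisVec]
    split_ifs <;> first | rfl | omega
  · rintro _ ⟨x, rfl⟩
    change trunc n x ∈ _
    rw [trunc_apply]
    exact Submodule.sum_mem _ fun i hi => Submodule.smul_mem _ _
      (Submodule.subset_span (Finset.mem_coe.2 (Finset.mem_image_of_mem _ hi)))

/-- If `T` is bounded below on the coordinates from the `n`-th on, its compression
`Q T⋆T Q + P` is coercive and hence invertible. -/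
theorem exists_inverse_compression {T G : StdModule A →L[A] StdModule A}
    (hTG : ∀ x y, ⟪T x, y⟫_A = ⟪x, G y⟫_A) {n : ℕ} {c : ℝ} (hc : 0 < c)
    (h : ∀ x, c * ‖tail n x‖ ≤ ‖T (tail n x)‖) :
    ∃ R : StdModule A →L[A] StdModule A,
      (∀ x, tail n (G (T (tail n (R x)))) + trunc n (R x) = x) ∧
      ∀ x, R (tail n (G (T (tail n x))) + trunc n x) = x := by
  have hGT : ∀ x y, ⟪G x, y⟫_A = ⟪x, T y⟫_A := fun x y => by
    rw [← CStarModule.star_inner, ← hTG, CStarModule.star_inner]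
  set d : ℝ := min c 1
  have hd : 0 < d := lt_min hc one_pos
  have hd1 : d ^ 2 ≤ 1 := pow_le_one₀ hd.le (min_le_right _ _)
  have hdT : ∀ x, d ^ 2 • ⟪tail n x, tail n x⟫_A ≤ ⟪T (tail n x), T (tail n x)⟫_A := fun x =>
    LinearMap.smul_inner_self_le_of_norm_le (tail n).toLinearMap (T.comp (tail n)).toLinearMap hd.le
      (fun x => (mul_le_mul_of_nonneg_right (min_le_left _ _) (norm_nonneg _)).trans (h x)) x
  refine exists_inverse_of_coercive
    ((tail n).comp (G.comp (T.comp (tail n))) + trunc n) (fun x y => ?_) (c := d ^ 2)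
    (by positivity) (fun x => ?_)
  · change ⟪tail n (G (T (tail n x))) + trunc n x, y⟫_A =
      ⟪x, tail n (G (T (tail n y))) + trunc n y⟫_A
    rw [CStarModule.inner_add_left, CStarModule.inner_add_right, inner_tail_left, hGT, hTG,
      inner_tail_left, inner_trunc_left]
  · change _ ≤ ⟪x, tail n (G (T (tail n x))) + trunc n x⟫_A
    have hP : ⟪x, trunc n x⟫_A = ⟪trunc n x, trunc n x⟫_A := by
      rw [inner_trunc_left, trunc_trunc]
    rw [CStarModule.inner_add_right, ← inner_tail_left, ← hTG, hP, inner_self_eq_add n x, smul_add]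
    refine add_le_add (hdT x) ?_
    calc _ ≤ (1 : ℝ) • ⟪trunc n x, trunc n x⟫_A :=
          smul_le_smul_of_nonneg_right hd1 CStarModule.inner_self_nonneg
      _ = _ := one_smul _ _

/-- A vector of `ker T` is determined by its first `n` coordinates, through an `A`-linear map `W`;
this identifies `ker T` with the kernel of `T W` on `Aⁿ`. -/
theorem fg_ker_of_bounded_below [WStarAlgebra A] {T G : StdModule A →L[A] StdModule A}
    (hTG : ∀ x y, ⟪T x, y⟫_A = ⟪x, G y⟫_A) {n : ℕ} {c : ℝ} (hc : 0 < c)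
    (h : ∀ x, c * ‖tail n x‖ ≤ ‖T (tail n x)‖) :
    (LinearMap.ker T.toLinearMap).FG := by
  obtain ⟨R, -, hR⟩ := exists_inverse_compression hTG hc h
  set W : StdModule A →ₗ[A] StdModule A := (trunc n).toLinearMap -
    (R.comp ((tail n).comp (G.comp (T.comp (trunc n))))).toLinearMap with hW
  have hWx : ∀ x, W x = trunc n x - R (tail n (G (T (trunc n x)))) := fun x => rfl
  have hker : ∀ x, T x = 0 → W x = x := fun x hx => by
    have h1 : T (tail n x) = -T (trunc n x) := by
      rw [tail_apply, map_sub, hx, zero_sub]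
    have h2 := hR (tail n x)
    rw [tail_tail, trunc_tail, add_zero, h1, map_neg, map_neg, map_neg] at h2
    rw [hWx, sub_eq_add_neg, h2, trunc_add_tail]
  have e : LinearMap.ker T.toLinearMap =
      (LinearMap.ker (T.toLinearMap ∘ₗ W) ⊓ LinearMap.range (trunc (A := A) n).toLinearMap).map
        W := by
    refine le_antisymm (fun x hx => ?_) ?_
    · have hx' : T x = 0 := hx
      have hx2 : W (trunc n x) = x := by
        rw [hWx, trunc_trunc, ← hWx, hker x hx']
      refine ⟨trunc n x, ⟨?_, ⟨x, rfl⟩⟩, hx2⟩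
      change T (W (trunc n x)) = 0
      rw [hx2, hx']
    · rintro _ ⟨x, ⟨hx, -⟩, rfl⟩
      exact hx
  rw [e]
  exact (fg_ker_inf_range_trunc _ n).map W

/-- The decompositions are those given by the idempotents `V F` and `F V`, where `V` inverts `Q F`
from the right on the range of `Q`; the kernel of `F V` is `Aⁿ`. -/
theorem isLowerSemiFredholm_of_bounded_below {F T : StdModule A →L[A] StdModule A}
    (hFT : ∀ x y, ⟪F x, y⟫_A = ⟪x, T y⟫_A) {n : ℕ} {c : ℝ} (hc : 0 < c)
    (h : ∀ x, c * ‖tail n x‖ ≤ ‖T (tail n x)‖) : IsLowerSemiFredholm F := by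
  have hTF : ∀ x y, ⟪T x, y⟫_A = ⟪x, F y⟫_A := fun x y => by
    rw [← CStarModule.star_inner, ← hFT, CStarModule.star_inner]
  obtain ⟨R, hR, -⟩ := exists_inverse_compression hTF hc h
  have hPR : ∀ x, trunc n (R x) = trunc n x := fun x => by
    have h1 := congrArg (trunc n) (hR x)
    rwa [map_add, trunc_tail, zero_add, trunc_trunc] at h1
  -- `V = T Q R Q` is a right inverse of `Q F` on the range of `Q`.
  set V : StdModule A →L[A] StdModule A := T.comp ((tail n).comp (R.comp (tail n))) with hV
  have hQFV : ∀ x, tail n (F (V x)) = tail n x := fun x => by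
    have h1 := hR (tail n x)
    rw [hPR, trunc_tail, add_zero] at h1
    exact h1
  have hVQ : ∀ x, V (tail n x) = V x := fun x => by
    change T (tail n (R (tail n (tail n x)))) = _
    rw [tail_tail]
    rfl
  have hVFV : ∀ x, V (F (V x)) = V x := fun x => by
    rw [← hVQ (F (V x)), hQFV, hVQ]
  set e₁ : StdModule A →L[A] StdModule A := V.comp F with he₁
  set e₂ : StdModule A →L[A] StdModule A := F.comp V with he₂
  have hi₁ : ∀ x, e₁ (e₁ x) = e₁ x := fun x => hVFV (F x)
  have hi₂ : ∀ x, e₂ (e₂ x) = e₂ x := fun x => congrArg F (hVFV x)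
  have hrange : ∀ e : StdModule A →L[A] StdModule A, (∀ x, e (e x) = e x) → ∀ x,
      x ∈ LinearMap.range e.toLinearMap ↔ e x = x := fun e he x =>
    ⟨by rintro ⟨y, rfl⟩; exact he y, fun hx => ⟨x, hx⟩⟩
  have hclosed : ∀ e : StdModule A →L[A] StdModule A, (∀ x, e (e x) = e x) →
      IsClosed (LinearMap.range e.toLinearMap : Set (StdModule A)) := fun e he => by
    have : (LinearMap.range e.toLinearMap : Set (StdModule A)) = {x | e x = x} :=
      Set.ext (hrange e he)
    rw [this]
    exact isClosed_eq e.continuous continuous_id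
  have hclosed' : ∀ e : StdModule A →L[A] StdModule A,
      IsClosed (LinearMap.ker e.toLinearMap : Set (StdModule A)) := fun e =>
    isClosed_eq e.continuous continuous_const
  have hcompl : ∀ e : StdModule A →L[A] StdModule A, (∀ x, e (e x) = e x) →
      IsCompl (LinearMap.range e.toLinearMap) (LinearMap.ker e.toLinearMap) := fun e he =>
    LinearMap.IsIdempotentElem.isCompl (f := e.toLinearMap) (LinearMap.ext he)
  have hm₁ : ∀ x ∈ LinearMap.range e₁.toLinearMap, V (F x) = x := fun x hx =>
    (hrange e₁ hi₁ x).1 hx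
  have hm₂ : ∀ y ∈ LinearMap.range e₂.toLinearMap, F (V y) = y := fun y hy =>
    (hrange e₂ hi₂ y).1 hy
  refine ⟨⟨T, hFT⟩, LinearMap.range e₁.toLinearMap, LinearMap.ker e₁.toLinearMap,
    LinearMap.range e₂.toLinearMap, LinearMap.ker e₂.toLinearMap, hclosed e₁ hi₁, hclosed' e₁,
    hclosed e₂ hi₂, hclosed' e₂, hcompl e₁ hi₁, hcompl e₂ hi₂, ?_, ?_, ?_⟩
  · refine ⟨ContinuousLinearEquiv.equivOfInverse
      ((F.comp (Submodule.subtypeL _)).codRestrict _ fun x => ⟨F x, ?_⟩)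
      ((V.comp (Submodule.subtypeL _)).codRestrict _ fun y => ⟨V y, hVFV y⟩)
      (fun x => Subtype.ext (hm₁ x x.2)) (fun y => Subtype.ext (hm₂ y y.2)), fun x => rfl⟩
    exact congrArg F (hm₁ x x.2)
  · intro x hx
    have hx' : V (F x) = 0 := hx
    change F (V (F x)) = 0
    rw [hx', map_zero]
  · have e : LinearMap.ker e₂.toLinearMap = LinearMap.range (trunc (A := A) n).toLinearMap := by
      ext x
      rw [mem_range_trunc_iff]
      refine ⟨fun hx => ?_, fun hx => ?_⟩
      · have hx' : F (V x) = 0 := hx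
        have h1 := hQFV x
        rw [hx', map_zero] at h1
        rw [← sub_eq_zero, ← neg_sub, ← tail_apply, ← h1, neg_zero]
      · change F (V x) = 0
        rw [← hVQ, ← hx, tail_trunc, map_zero, map_zero]
    rw [e]
    exact fg_range_trunc n

end StdModule

/-! ### Finitely generated submodules and compact operators -/

section FinitelyGenerated

variable {A E : Type*} [CStarAlgebra A] [PartialOrder A] [StarOrderedRing A]
  [NormedAddCommGroup E] [NormedSpace ℂ E] [Module A E] [IsScalarTower ℂ A E] [CStarModule A E]

/-- The map `a ↦ ∑ aᵢ vᵢ` from `Aⁿ`, as a bounded operator. -/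
noncomputable def linearCombinationCLM {n : ℕ} (v : Fin n → E) : (Fin n → A) →L[ℂ] E :=
  LinearMap.mkContinuous
    { toFun := fun a => ∑ i, a i • v i
      map_add' := fun a b => by simp [add_smul, Finset.sum_add_distrib]
      map_smul' := fun c a => by simp [Finset.smul_sum] } (∑ i, ‖v i‖) fun a => by
    change ‖∑ i, a i • v i‖ ≤ _
    refine (norm_sum_le _ _).trans ?_
    rw [Finset.sum_mul]
    refine Finset.sum_le_sum fun i _ => ?_
    refine (CStarModule.norm_smul_le _ _).trans ?_
    rw [mul_comm]
    gcongr
    exact norm_le_pi_norm a i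

theorem linearCombinationCLM_apply {n : ℕ} (v : Fin n → E) (a : Fin n → A) :
    linearCombinationCLM v a = ∑ i, a i • v i := rfl

theorem norm_inner_linearCombinationCLM_le {n : ℕ} (v : Fin n → E) (a : Fin n → A) (y : E) :
    ‖⟪linearCombinationCLM v a, y⟫_A‖ ≤ (∑ i, ‖⟪v i, y⟫_A‖) * ‖a‖ := by
  rw [linearCombinationCLM_apply, CStarModule.inner_sum_left, Finset.sum_mul]
  refine (norm_sum_le _ _).trans (Finset.sum_le_sum fun i _ => ?_)
  rw [CStarModule.inner_op_smul_left]
  refine (norm_mul_le _ _).trans ?_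
  rw [norm_star]
  gcongr
  exact norm_le_pi_norm a i

end FinitelyGenerated

namespace StdModule

open Filter Topology

variable {A : Type*} [CStarAlgebra A] [PartialOrder A] [StarOrderedRing A]

/-- A bounded sequence in a closed finitely generated submodule which tends to zero weakly tends
to zero in norm. -/
theorem tendsto_zero_of_mem_fg {N : Submodule A (StdModule A)}
    (hN : N.FG) (hc : IsClosed (N : Set (StdModule A))) {x : ℕ → StdModule A} (hx : ∀ k, x k ∈ N)
    {r : ℝ} (hr : ∀ k, ‖x k‖ ≤ r)
    (hw : ∀ v, Tendsto (fun k => ⟪v, x k⟫_A) atTop (𝓝 0)) : Tendsto x atTop (𝓝 0) := by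
  obtain ⟨n, v, hv⟩ := Submodule.fg_iff_exists_fin_generating_family.1 hN
  have hmem : ∀ y, y ∈ N ↔ ∃ a : Fin n → A, linearCombinationCLM v a = y := fun y => by
    rw [← hv]
    exact Submodule.mem_span_range_iff_exists_fun A
  have : CompleteSpace (N.restrictScalars ℂ) := hc.completeSpace_coe
  obtain ⟨C, hC, hΦ⟩ := ((linearCombinationCLM v).codRestrict (N.restrictScalars ℂ) fun a =>
    (hmem _).2 ⟨a, rfl⟩).exists_preimage_norm_le fun y => by
      obtain ⟨a, ha⟩ := (hmem y).1 y.2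
      exact ⟨a, Subtype.ext ha⟩
  have hbound : ∀ k, ‖x k‖ ^ 2 ≤ (∑ i, ‖⟪v i, x k⟫_A‖) * (C * r) := fun k => by
    obtain ⟨a, ha, hle⟩ := hΦ ⟨x k, hx k⟩
    have ha' : linearCombinationCLM v a = x k := congrArg Subtype.val ha
    have hle' : ‖a‖ ≤ C * ‖x k‖ := hle
    rw [CStarModule.norm_sq_eq A]
    nth_rw 1 [← ha']
    refine (norm_inner_linearCombinationCLM_le v a (x k)).trans ?_
    gcongr
    exact hle'.trans (by gcongr; exact hr k)
  rw [tendsto_zero_iff_norm_tendsto_zero]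
  have h1 : Tendsto (fun k => (∑ i, ‖⟪v i, x k⟫_A‖) * (C * r)) atTop (𝓝 0) := by
    have h2 := (tendsto_finsetSum Finset.univ fun i _ => (hw (v i)).norm).mul_const (C * r)
    simpa using h2
  have h3 := (squeeze_zero (fun k => sq_nonneg _) hbound h1).sqrt
  simpa [Real.sqrt_sq] using h3

/-- If the range of `F` and a finitely generated submodule span everything, then the adjoint of
`F` is bounded below on a tail: by the open mapping theorem the two together bound `‖y‖`, and a
finitely generated submodule is almost orthogonal to a tail. -/
theorem bounded_below_tail_of_range_add_fg {F G : StdModule A →L[A] StdModule A}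
    (hFG : ∀ x y, ⟪F x, y⟫_A = ⟪x, G y⟫_A) {N : Submodule A (StdModule A)} (hN : N.FG)
    (h : ∀ y, ∃ w, ∃ z ∈ N, F w + z = y) :
    ∃ c > 0, ∀ᶠ m in atTop, ∀ x, c * ‖tail m x‖ ≤ ‖G (tail m x)‖ := by
  obtain ⟨n, v, hv⟩ := Submodule.fg_iff_exists_fin_generating_family.1 hN
  obtain ⟨C, hC, hΦ⟩ := (ContinuousLinearMap.coprod (F.restrictScalars ℂ)
    (linearCombinationCLM (A := A) v)).exists_preimage_norm_le fun y => by
      obtain ⟨w, z, hz, hwz⟩ := h y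
      rw [← hv] at hz
      obtain ⟨a, ha⟩ := (Submodule.mem_span_range_iff_exists_fun A).1 hz
      exact ⟨(w, a), by rw [← hwz, ← ha]; rfl⟩
  have hbound : ∀ y, ‖y‖ ≤ C * (‖G y‖ + ∑ i, ‖⟪v i, y⟫_A‖) := fun y => by
    rcases eq_or_lt_of_le (norm_nonneg y) with h0 | h0
    · rw [← h0]; positivity
    obtain ⟨⟨w, a⟩, hwa, hle⟩ := hΦ y
    have hwa' : F w + linearCombinationCLM v a = y := hwa
    have hw : ‖w‖ ≤ C * ‖y‖ := (norm_fst_le (w, a)).trans hle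
    have ha : ‖a‖ ≤ C * ‖y‖ := (norm_snd_le (w, a)).trans hle
    have h1 : ‖y‖ ^ 2 ≤ ‖w‖ * ‖G y‖ + (∑ i, ‖⟪v i, y⟫_A‖) * ‖a‖ := by
      rw [CStarModule.norm_sq_eq A]
      nth_rw 1 [← hwa']
      rw [CStarModule.inner_add_left, hFG]
      exact (norm_add_le _ _).trans (add_le_add (CStarModule.norm_inner_le _)
        (norm_inner_linearCombinationCLM_le v a y))
    have h2 : ‖w‖ * ‖G y‖ + (∑ i, ‖⟪v i, y⟫_A‖) * ‖a‖ ≤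
        (C * ‖y‖) * ‖G y‖ + (∑ i, ‖⟪v i, y⟫_A‖) * (C * ‖y‖) := by gcongr
    refine le_of_mul_le_mul_right ?_ h0
    linarith
  have hsmall : Tendsto (fun m => C * ∑ i, ‖tail m (v i)‖) atTop (𝓝 0) := by
    have h2 := (tendsto_finsetSum Finset.univ fun i _ => (tendsto_tail (v i)).norm).const_mul C
    simpa using h2
  refine ⟨1 / (2 * C), by positivity, ?_⟩
  filter_upwards [hsmall.eventually_le_const (show (0 : ℝ) < 1 / 2 by norm_num)] with m hm x
  have h1 := hbound (tail m x)
  have h2 : ∑ i, ‖⟪v i, tail m x⟫_A‖ ≤ (∑ i, ‖tail m (v i)‖) * ‖tail m x‖ := by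
    rw [Finset.sum_mul]
    refine Finset.sum_le_sum fun i _ => ?_
    rw [← tail_tail m x, ← inner_tail_left, tail_tail]
    exact CStarModule.norm_inner_le _
  have h3 : C * ∑ i, ‖⟪v i, tail m x⟫_A‖ ≤ 1 / 2 * ‖tail m x‖ :=
    (mul_le_mul_of_nonneg_left h2 hC.le).trans (by rw [← mul_assoc]; gcongr)
  rw [one_div_mul_eq_div, div_le_iff₀ (by positivity)]
  linarith

/-- The adjoint of a compact operator is small on tails. -/
theorem eventually_norm_adjoint_tail_le {K G : StdModule A →L[A] StdModule A}
    (hKG : ∀ x y, ⟪K x, y⟫_A = ⟪x, G y⟫_A) (hK : IsCompactAdjointable K) {ε : ℝ} (hε : 0 < ε) :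
    ∀ᶠ m in atTop, ∀ x, ‖G (tail m x)‖ ≤ ε * ‖tail m x‖ := by
  set Q : ℕ → StdModule A →L[ℂ] StdModule A := fun m => (tail m).restrictScalars ℂ with hQ
  have hspan : ∀ B ∈ Submodule.span ℂ {T : StdModule A →L[ℂ] StdModule A |
      ∃ x y : StdModule A, T = (elementaryOp (A := A) x y).restrictScalars ℂ},
      Tendsto (fun m => (Q m).comp B) atTop (𝓝 0) := by
    intro B hB
    induction hB using Submodule.span_induction with
    | mem B hB =>
      obtain ⟨x, y, rfl⟩ := hB
      have h1 : Tendsto (fun m => ‖tail m x‖ * ‖y‖) atTop (𝓝 0) := by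
        simpa using (tendsto_tail x).norm.mul_const ‖y‖
      refine squeeze_zero_norm (fun m => ?_) h1
      refine ContinuousLinearMap.opNorm_le_bound _ (by positivity) fun z => ?_
      change ‖tail m (⟪y, z⟫_A • x)‖ ≤ _
      rw [map_smul]
      refine (CStarModule.norm_smul_le _ _).trans ?_
      calc _ ≤ (‖y‖ * ‖z‖) * ‖tail m x‖ := by
            gcongr
            exact CStarModule.norm_inner_le _
        _ = _ := by ring
    | zero => simp
    | add B B' _ _ h h' => simpa using h.add h'
    | smul c B _ h => simpa using h.const_smul c
  obtain ⟨B, hB, hBK⟩ := Metric.mem_closure_iff.1 hK.2 (ε / 2) (by positivity)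
  rw [dist_eq_norm] at hBK
  filter_upwards [(hspan B hB).norm.eventually_le_const
    (show ‖(0 : StdModule A →L[ℂ] StdModule A)‖ < ε / 2 by rw [norm_zero]; positivity)]
    with m hm x
  have hQK : ∀ w, ‖tail m (K w)‖ ≤ ε * ‖w‖ := fun w => by
    have h1 : tail m (K w) = tail m ((K.restrictScalars ℂ - B) w) + (Q m).comp B w := by
      change _ = tail m (K w - B w) + tail m (B w)
      rw [← map_add, sub_add_cancel]
    rw [h1]
    calc _ ≤ ‖tail m ((K.restrictScalars ℂ - B) w)‖ + ‖(Q m).comp B w‖ := norm_add_le _ _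
      _ ≤ ε / 2 * ‖w‖ + ε / 2 * ‖w‖ := by
          gcongr
          · exact (norm_tail_le _ _).trans (((K.restrictScalars ℂ - B).le_opNorm w).trans
              (by gcongr))
          · exact (((Q m).comp B).le_opNorm w).trans (by gcongr)
      _ = ε * ‖w‖ := by ring
  rcases eq_or_lt_of_le (norm_nonneg (G (tail m x))) with h0 | h0
  · rw [← h0]; positivity
  refine le_of_mul_le_mul_left ?_ h0
  have h1 : ⟪K (G (tail m x)), tail m x⟫_A = ⟪tail m (K (G (tail m x))), tail m x⟫_A := by
    rw [inner_tail_left, tail_tail]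
  rw [← sq, CStarModule.norm_sq_eq A, ← hKG, h1]
  refine (CStarModule.norm_inner_le _).trans ?_
  calc _ ≤ (ε * ‖G (tail m x)‖) * ‖tail m x‖ := by
        gcongr
        exact hQK _
    _ = _ := by ring

/-- The adjoint of `F - K` is bounded below on a tail, as that of `F` is. -/
theorem fg_orthogonalComplement_of_isLowerSemiFredholm [WStarAlgebra A]
    {F K : StdModule A →L[A] StdModule A} (hF : IsLowerSemiFredholm F)
    (hK : IsCompactAdjointable K) :
    (orthogonalComplement (LinearMap.range ((F - K).toLinearMap))).FG := by
  obtain ⟨⟨G, hFG⟩, M₁, N₁, M₂, N₂, -, -, -, -, -, hcompl, ⟨F₁, hF₁⟩, -, hN₂⟩ := hF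
  obtain ⟨⟨L, hKL⟩, -⟩ := id hK
  have hsub : ∀ x y, ⟪(F - K) x, y⟫_A = ⟪x, (G - L) y⟫_A := fun x y => by
    simp [hFG, hKL]
  have hsub' : ∀ x y, ⟪(G - L) x, y⟫_A = ⟪x, (F - K) y⟫_A := fun x y => by
    rw [← CStarModule.star_inner, ← hsub, CStarModule.star_inner]
  obtain ⟨c, hc, hlow⟩ := bounded_below_tail_of_range_add_fg hFG hN₂ fun y => by
    obtain ⟨m, hm, z, hz, rfl⟩ := Submodule.mem_sup.1
      (hcompl.sup_eq_top ▸ Submodule.mem_top : y ∈ M₂ ⊔ N₂)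
    exact ⟨F₁.symm ⟨m, hm⟩, z, hz, by rw [← hF₁, F₁.apply_symm_apply]⟩
  obtain ⟨m, hm, hm'⟩ :=
    (hlow.and (eventually_norm_adjoint_tail_le hKL hK (half_pos hc))).exists
  have e : orthogonalComplement (LinearMap.range ((F - K).toLinearMap)) =
      LinearMap.ker (G - L).toLinearMap := by
    ext y
    exact mem_orthogonalComplement_range_iff hsub y
  rw [e]
  refine fg_ker_of_bounded_below hsub' (n := m) (half_pos hc) fun x => ?_
  have h1 := norm_sub_norm_le (G (tail m x)) (L (tail m x))
  have h2 := hm x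
  have h3 := hm' x
  change _ ≤ ‖G (tail m x) - L (tail m x)‖
  linarith

end StdModule

/-! ### A compact perturbation with large kernel -/

section Cutoff

variable {A E : Type*} [CStarAlgebra A] [PartialOrder A] [StarOrderedRing A]
  [NormedAddCommGroup E] [NormedSpace ℂ E] [Module A E] [IsScalarTower ℂ A E] [CStarModule A E]

/-- A substitute for normalizing `x` so that `⟨x, x⟩` is a projection: continuous functions `b` and
`d` of `a = ⟨x, x⟩` with `b a d = b`, where `b` is a cutoff to the part of the spectrum above
`1 / 2` and `d` is an inverse of `a` there. -/
theorem exists_cutoff (x : E) (hx : ‖x‖ = 1) :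
    ∃ b d : A, ⟪d • x, b • x⟫_A = b ∧ 1 / 2 ≤ ‖b • x‖ ∧ ‖b‖ ≤ 1 ∧ ‖d‖ ≤ 2 := by
  set a := ⟪x, x⟫_A with ha
  have ha0 : 0 ≤ a := CStarModule.inner_self_nonneg
  have hsa : IsSelfAdjoint a := IsSelfAdjoint.of_nonneg ha0
  have hna : ‖a‖ = 1 := by rw [ha, ← CStarModule.norm_sq_eq, hx, one_pow]
  have : Nontrivial A := ⟨a, 0, fun h => by simp [h] at hna⟩
  have h1 : (1 : ℝ) ∈ spectrum ℝ a := hna ▸ CStarAlgebra.norm_mem_spectrum_of_nonneg ha0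
  let f : ℝ → ℝ := fun t => max 0 (t - 1 / 2)
  let g : ℝ → ℝ := fun t => (max t (1 / 2))⁻¹
  have hf : Continuous f := by fun_prop
  have hpos : ∀ t : ℝ, 0 < max t (1 / 2) := fun t => lt_max_of_lt_right (by norm_num)
  have hg : Continuous g := Continuous.inv₀ (by fun_prop) fun t => (hpos t).ne'
  have hid : cfc (fun t : ℝ => t) a = a := cfc_id' ℝ a
  have hfs : star (cfc f a) = cfc f a := (cfc_predicate f a : IsSelfAdjoint _).star_eq
  have hgs : star (cfc g a) = cfc g a := (cfc_predicate g a : IsSelfAdjoint _).star_eq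
  refine ⟨cfc f a, cfc g a, ?_, ?_, ?_, ?_⟩
  · rw [CStarModule.inner_op_smul_left, CStarModule.inner_op_smul_right, hgs, ← ha]
    nth_rw 2 [← hid]
    rw [← cfc_mul f (fun t => t) a hf.continuousOn continuousOn_id,
      ← cfc_mul (fun t => f t * t) g a (hf.mul continuous_id).continuousOn hg.continuousOn]
    congr 1
    funext t
    simp only [f, g]
    rcases le_total t (1 / 2) with ht | ht
    · rw [max_eq_left (by linarith), zero_mul, zero_mul]
    · rw [max_eq_left ht, mul_assoc, mul_inv_cancel₀ (by linarith), mul_one]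
  · refine le_of_sq_le_sq ?_ (norm_nonneg _)
    rw [CStarModule.norm_sq_eq A, CStarModule.inner_op_smul_left, CStarModule.inner_op_smul_right,
      hfs, ← ha]
    nth_rw 2 [← hid]
    rw [← cfc_mul f (fun t => t) a hf.continuousOn continuousOn_id,
      ← cfc_mul (fun t => f t * t) f a (hf.mul continuous_id).continuousOn hf.continuousOn]
    refine le_trans ?_ (norm_apply_le_norm_cfc (fun t => f t * t * f t) a h1
      ((hf.mul continuous_id).mul hf).continuousOn hsa)
    norm_num [f]
  · refine norm_cfc_le zero_le_one fun t ht => ?_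
    have h2 := spectrum.norm_le_norm_of_mem ht
    rw [hna, Real.norm_eq_abs] at h2
    rw [Real.norm_of_nonneg (le_max_left _ _)]
    exact max_le zero_le_one (by linarith [le_abs_self t])
  · refine norm_cfc_le zero_le_two fun t _ => ?_
    rw [Real.norm_of_nonneg (inv_nonneg.2 (hpos t).le)]
    exact inv_le_of_inv_le₀ two_pos ((le_max_right _ _).trans' (by norm_num))

end Cutoff

section SeriesOfElementaryOperators

variable {A E : Type*} [CStarAlgebra A] [PartialOrder A] [StarOrderedRing A]
  [NormedAddCommGroup E] [NormedSpace ℂ E] [Module A E] [IsScalarTower ℂ A E] [CStarModule A E]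

/-- The norm limit of the partial sums is again `A`-linear. -/
theorem exists_hasSum_elementaryOp [CompleteSpace E] (x y : ℕ → E)
    (h : Summable fun k => ‖x k‖ * ‖y k‖) :
    ∃ K : E →L[A] E, HasSum (fun k => (elementaryOp (A := A) (x k) (y k)).restrictScalars ℂ)
      (K.restrictScalars ℂ) := by
  have hs : Summable fun k => (elementaryOp (A := A) (x k) (y k)).restrictScalars ℂ := by
    refine Summable.of_norm_bounded h fun k => ?_
    refine ContinuousLinearMap.opNorm_le_bound _ (by positivity) fun z => ?_
    change ‖⟪y k, z⟫_A • x k‖ ≤ _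
    refine (CStarModule.norm_smul_le _ _).trans ?_
    calc _ ≤ (‖y k‖ * ‖z‖) * ‖x k‖ := by
          gcongr
          exact CStarModule.norm_inner_le _
      _ = _ := by ring
  set S := ∑' k, (elementaryOp (A := A) (x k) (y k)).restrictScalars ℂ with hS
  have happ : ∀ z, HasSum (fun k => ⟪y k, z⟫_A • x k) (S z) := fun z =>
    hs.hasSum.mapL (ContinuousLinearMap.apply ℂ E z)
  refine ⟨⟨⟨⟨S, map_add S⟩, fun a z => ?_⟩, S.cont⟩, hs.hasSum⟩
  have hcont : Continuous fun w : E => a • w :=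
    AddMonoidHomClass.continuous_of_bound (DistribSMul.toAddMonoidHom E a) ‖a‖
      fun w => CStarModule.norm_smul_le a w
  have h1 : HasSum (fun k => a • ⟪y k, z⟫_A • x k) (a • S z) :=
    (happ z).map (DistribSMul.toAddMonoidHom E a) hcont
  exact (happ (a • z)).unique (by simpa [mul_smul] using h1)

/-- A norm-convergent series of elementary operators is an adjointable compact operator, whose
adjoint is the series of the flipped elementary operators. -/
theorem exists_isCompactAdjointable_hasSum [CompleteSpace E] (x y : ℕ → E)
    (h : Summable fun k => ‖x k‖ * ‖y k‖) :
    ∃ K L : E →L[A] E, IsCompactAdjointable K ∧ (∀ v w, ⟪K v, w⟫_A = ⟪v, L w⟫_A) ∧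
      ∀ w, HasSum (fun k => ⟪x k, w⟫_A • y k) (L w) := by
  obtain ⟨K, hK⟩ := exists_hasSum_elementaryOp (A := A) x y h
  obtain ⟨L, hL⟩ := exists_hasSum_elementaryOp (A := A) y x (by simpa only [mul_comm] using h)
  have hKa : ∀ v, HasSum (fun k => ⟪y k, v⟫_A • x k) (K v) := fun v =>
    hK.mapL (ContinuousLinearMap.apply ℂ E v)
  have hLa : ∀ w, HasSum (fun k => ⟪x k, w⟫_A • y k) (L w) := fun w =>
    hL.mapL (ContinuousLinearMap.apply ℂ E w)
  have hadj : ∀ v w, ⟪K v, w⟫_A = ⟪v, L w⟫_A := fun v w => by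
    have h1 : HasSum (fun k => ⟪⟪y k, v⟫_A • x k, w⟫_A) ⟪K v, w⟫_A :=
      (hKa v).mapL ((CStarModule.innerSL (A := A) (E := E)).flip w)
    have h2 : HasSum (fun k => ⟪v, ⟪x k, w⟫_A • y k⟫_A) ⟪v, L w⟫_A :=
      (hLa w).mapL (CStarModule.innerSL (A := A) v)
    simp only [CStarModule.inner_op_smul_left, CStarModule.inner_op_smul_right,
      CStarModule.star_inner] at h1 h2
    exact h1.unique h2
  refine ⟨K, L, ⟨⟨L, hadj⟩, ?_⟩, hadj, hLa⟩
  refine mem_closure_of_tendsto hK (Filter.Eventually.of_forall fun s => ?_)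
  exact Submodule.sum_mem _ fun k _ => Submodule.subset_span ⟨x k, y k, rfl⟩

end SeriesOfElementaryOperators

namespace StdModule

open Filter Topology

variable {A : Type*} [CStarAlgebra A] [PartialOrder A] [StarOrderedRing A]

theorem tail_trunc_comm (m n : ℕ) (x : StdModule A) :
    tail m (trunc n x) = trunc n (tail m x) := by
  ext j
  simp only [coord_tail, coord_trunc]
  split_ifs <;> rfl

theorem tendsto_trunc (x : StdModule A) : Tendsto (fun n => trunc n x) atTop (𝓝 x) := by
  have h := (tendsto_tail x).const_sub x
  simpa [tail_apply] using h

theorem trunc_trunc_of_le {m n : ℕ} (h : m ≤ n) (x : StdModule A) :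
    trunc n (trunc m x) = trunc m x := by
  ext j
  simp only [coord_trunc]
  split_ifs <;> first | rfl | omega

/-- Truncation makes a vector of the tail on which `T` is small finitely supported. -/
theorem exists_block {T : StdModule A →L[A] StdModule A}
    (hT : ¬∃ n, ∃ c > 0, ∀ x, c * ‖tail n x‖ ≤ ‖T (tail n x)‖) (n : ℕ) {ε : ℝ} (hε : 0 < ε) :
    ∃ N > n, ∃ x, tail n x = x ∧ trunc N x = x ∧ ‖x‖ = 1 ∧ ‖T x‖ ≤ ε := by
  push Not at hT
  obtain ⟨x, hx⟩ := hT n ε hε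
  set y := tail n x with hy
  have h1 : ∀ᶠ N in atTop, ‖T (trunc N y)‖ < ε * ‖trunc N y‖ :=
    (((T.continuous.tendsto y).comp (tendsto_trunc y)).norm).eventually_lt
      ((tendsto_trunc y).norm.const_mul ε) hx
  obtain ⟨N, hN, hNn⟩ := (h1.and (eventually_gt_atTop n)).exists
  set w := trunc N y with hw
  have hw0 : 0 < ‖w‖ := by
    by_contra h
    have h0 : ‖w‖ = 0 := le_antisymm (not_lt.1 h) (norm_nonneg _)
    rw [h0, mul_zero] at hN
    exact absurd hN (not_lt.2 (norm_nonneg _))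
  have hs : ∀ (B : StdModule A →L[A] StdModule A) (c : ℂ) v, B (c • v) = c • B v :=
    fun B c v => (B.restrictScalars ℂ).map_smul c v
  have hn : ‖((‖w‖⁻¹ : ℝ) : ℂ)‖ = ‖w‖⁻¹ := by
    rw [Complex.norm_real, Real.norm_of_nonneg (inv_nonneg.2 hw0.le)]
  refine ⟨N, hNn, ((‖w‖⁻¹ : ℝ) : ℂ) • w, ?_, ?_, ?_, ?_⟩
  · rw [hs, hw, tail_trunc_comm, hy, tail_tail]
  · rw [hs, hw, trunc_trunc]
  · rw [norm_smul, hn, inv_mul_cancel₀ hw0.ne']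
  · rw [hs, norm_smul, hn, inv_mul_le_iff₀ hw0, mul_comm]
    exact hN.le

/-- If `T` is not bounded below on any tail, there are unit vectors `xₖ` with disjoint supports
tending to infinity for which `T xₖ` decays geometrically. -/
theorem exists_block_sequence {T : StdModule A →L[A] StdModule A}
    (hT : ¬∃ n, ∃ c > 0, ∀ x, c * ‖tail n x‖ ≤ ‖T (tail n x)‖) :
    ∃ (n : ℕ → ℕ) (x : ℕ → StdModule A), StrictMono n ∧ (∀ k, tail (n k) (x k) = x k) ∧
      (∀ k, trunc (n (k + 1)) (x k) = x k) ∧ (∀ k, ‖x k‖ = 1) ∧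
      ∀ k, ‖T (x k)‖ ≤ (1 / 2) ^ k := by
  choose N hN X h1 h2 h3 h4 using fun (n k : ℕ) =>
    exists_block hT n (show (0 : ℝ) < (1 / 2) ^ k by positivity)
  let n : ℕ → ℕ := fun k => Nat.rec 0 (fun k m => N m k) k
  exact ⟨n, fun k => X (n k) k, strictMono_nat_of_lt_succ fun k => hN (n k) k,
    fun k => h1 _ _, fun k => h2 _ _, fun k => h3 _ _, fun k => h4 _ _⟩

/-- If `T` were bounded below on no tail, there would be a compact `K` with adjoint `L` such that `T`
and `L` agree on a bounded sequence of vectors with disjoint supports and norms bounded away from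
zero; then `ker (T - L)` would not be finitely generated. -/
theorem bounded_below_tail_of_fg_ker {F T : StdModule A →L[A] StdModule A}
    (hFT : ∀ x y, ⟪F x, y⟫_A = ⟪x, T y⟫_A)
    (h : ∀ K : StdModule A →L[A] StdModule A, IsCompactAdjointable K →
      (orthogonalComplement (LinearMap.range ((F - K).toLinearMap))).FG) :
    ∃ n, ∃ c > 0, ∀ x, c * ‖tail n x‖ ≤ ‖T (tail n x)‖ := by
  by_contra hT
  obtain ⟨n, x, hn, hxt, hxn, hx1, hxT⟩ := exists_block_sequence hT
  have horth : ∀ j k, j ≠ k → ⟪x j, x k⟫_A = 0 := by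
    have hlt : ∀ j k, j < k → ⟪x j, x k⟫_A = 0 := fun j k hjk => by
      rw [← hxt k, ← inner_tail_left, ← hxn j, ← trunc_trunc_of_le (hn.monotone hjk) (x j),
        tail_trunc, CStarModule.inner_zero_left]
    intro j k hjk
    rcases lt_or_gt_of_ne hjk with hjk | hjk
    · exact hlt j k hjk
    · rw [← CStarModule.star_inner, hlt k j hjk, star_zero]
  choose b d hbd hb hb1 hd using fun k => exists_cutoff (A := A) (x k) (hx1 k)
  have hsum : Summable fun k => ‖d k • x k‖ * ‖T (x k)‖ := by
    refine Summable.of_nonneg_of_le (fun k => by positivity) (fun k => ?_)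
      (summable_geometric_two.mul_left 2)
    gcongr
    · refine (CStarModule.norm_smul_le _ _).trans ?_
      rw [hx1, mul_one]
      exact hd k
    · exact hxT k
  -- `L = ∑ ⟨dₖ xₖ, ·⟩ T xₖ` agrees with `T` at `bₖ xₖ`, as `⟨dₖ xₖ, bₖ xₖ⟩ = bₖ`.
  obtain ⟨K, L, hK, hKL, hL⟩ :=
    exists_isCompactAdjointable_hasSum (A := A) (fun k => d k • x k) (fun k => T (x k)) hsum
  have hsub : ∀ v w, ⟪(F - K) v, w⟫_A = ⟪v, (T - L) w⟫_A := fun v w => by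
    simp [hFT, hKL]
  have hmem : ∀ k, b k • x k ∈ orthogonalComplement (LinearMap.range (F - K).toLinearMap) := by
    intro k
    rw [mem_orthogonalComplement_range_iff hsub]
    have h1 : HasSum (fun j => ⟪d j • x j, b k • x k⟫_A • T (x j)) (b k • T (x k)) := by
      convert hasSum_single k fun j hj => ?_ using 1
      · rw [hbd]
      · simp [horth j k hj]
    change T (b k • x k) - L (b k • x k) = 0
    rw [(hL (b k • x k)).unique h1, map_smul, sub_self]
  have hclosed : IsClosed (orthogonalComplement (LinearMap.range (F - K).toLinearMap) :
      Set (StdModule A)) := by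
    have e : (orthogonalComplement (LinearMap.range (F - K).toLinearMap) : Set (StdModule A)) =
        {y | (T - L) y = 0} := Set.ext fun y => mem_orthogonalComplement_range_iff hsub y
    rw [e]
    exact isClosed_eq (T - L).continuous continuous_const
  have hbx : ∀ k, ‖b k • x k‖ ≤ 1 := fun k => by
    refine (CStarModule.norm_smul_le _ _).trans ?_
    rw [hx1, mul_one]
    exact hb1 k
  have hlim := tendsto_zero_of_mem_fg (h K hK) hclosed hmem hbx fun v => by
    refine squeeze_zero_norm (fun k => ?_) (tendsto_zero_iff_norm_tendsto_zero.1
      ((tendsto_tail v).comp hn.tendsto_atTop))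
    rw [CStarModule.inner_op_smul_right]
    calc _ ≤ ‖b k‖ * ‖⟪v, x k⟫_A‖ := norm_mul_le _ _
      _ ≤ 1 * (‖tail (n k) v‖ * ‖x k‖) := by
          gcongr
          · exact hb1 k
          · rw [← hxt k, ← inner_tail_left, hxt k]
            exact CStarModule.norm_inner_le _
      _ = _ := by rw [hx1, one_mul, mul_one]; rfl
  have h2 := ge_of_tendsto hlim.norm (Eventually.of_forall hb)
  rw [norm_zero] at h2
  norm_num at h2

end StdModule

theorem corollary3p6 {A : Type*} [CStarAlgebra A] [PartialOrder A] [StarOrderedRing A]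
    [WStarAlgebra A] (F : StdModule A →L[A] StdModule A) (hF : IsAdjointable F) :
    IsLowerSemiFredholm F ↔
      ∀ K : StdModule A →L[A] StdModule A, IsCompactAdjointable K →
        (orthogonalComplement (LinearMap.range ((F - K).toLinearMap))).FG := by
  refine ⟨fun h K hK => StdModule.fg_orthogonalComplement_of_isLowerSemiFredholm h hK,
    fun h => ?_⟩
  obtain ⟨T, hFT⟩ := hF
  obtain ⟨n, c, hc, hlow⟩ := StdModule.bounded_below_tail_of_fg_ker hFT h
  exact StdModule.isLowerSemiFredholm_of_bounded_below hFT hc hlow
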